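/- **Setting.** A tabular contextual bandit consists of a finite context set $\mathcal C$ with $S=|\mathcal C|$, a finite action set $\mathcal A$ with $A=|\mathcal A|$, a context distribution $\mu^\star$ on $\mathcal C$, and reward distributions $\nu(c,a)$ supported in $[0,1]$ with means $r(c,a)$; both $\mu^\star$ and $\nu$ are unknown to the learner. In each round a context $c\sim\mu^\star$ is drawn, the learner plays an action $a$ (depending on the past, on $c$, and possibly on internal randomness) and receives a reward drawn from $\nu(c,a)$; this is one sample. The learner decides after each round, from the data collected so far, whether to stop, and when it stops it returns a policy. For a (possibly randomized) policy $\pi$ let $\phi^\pi(c,a)=\mu^\star(c)\,\pi(a\mid c)$ and $V^\pi=\sum_{c,a}\phi^\pi(c,a)\,r(c,a)$. Let $\Pi$ be a finite set of at least two deterministic policies $\mathcal C\to\mathcal A$, let $\pi^\star\in\arg\max_{\pi\in\Pi}V^\pi$ (any maximizer), $V^\star=V^{\pi^\star}$, $\phi^\star=\phi^{\pi^\star}$, $\Delta_{\min}=\min_{\pi\in\Pi\setminus\{\pi^\star\}}(V^\star-V^\pi)$ (which is $0$ if the maximizer is not unique), and $\Delta(\pi)=\max\{V^\star-V^\pi,\Delta_{\min}\}$.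 For a randomized policy $\pi_{\exp}$ put $$\|\phi^\star-\phi^\pi\|^2_{\Lambda(\pi_{\exp})^{-1}}=\sum_{c,a}\frac{(\phi^\star(c,a)-\phi^\pi(c,a))^2}{\phi^{\pi_{\exp}}(c,a)},$$ with $0/0=0$ and $y/0=\infty$ for $y>0$. **Statement.** There are a universal constant $C>0$ and a universal polynomial $\mathrm{poly}$ in five variables such that for all finite $\mathcal C,\mathcal A$, every finite set $\Pi$ of at least two deterministic policies, every $\epsilon\ge 0$ and every $\kappa\in(0,1)$ there is an algorithm with the following property. On every contextual bandit as above with $\Delta_{\min}\vee\epsilon>0$, with probability at least $1-2\kappa$, the algorithm terminates, returns a policy $\hat\pi\in\Pi$ with $V^\star-V^{\hat\pi}\le\epsilon$, and has collected at most $$\inf_{\pi_{\exp}}\max_{\pi\in\Pi}\frac{\|\phi^\star-\phi^\pi\|^2_{\Lambda(\pi_{\exp})^{-1}}}{\max\{\epsilon^2,\Delta(\pi)^2\}}\cdot\beta^2\log\frac1{\Delta_{\min}\vee\epsilon}+\frac{C_{\mathrm{poly}}}{\max\{\epsilon^{5/3},\Delta_{\min}^{5/3}\}}$$ samples, where the infimum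 is over all randomized policies, $\beta=C\sqrt{\log\big(\tfrac{S|\Pi|}{\kappa}\cdot\tfrac1{\Delta_{\min}\vee\epsilon}\big)}$ (read as $0$ if the logarithm is negative, which can only happen for $\epsilon>1$), and $C_{\mathrm{poly}}=\mathrm{poly}\big(S,A,\log\tfrac1\kappa,\log\tfrac1{\Delta_{\min}\vee\epsilon},\log|\Pi|\big)$. -/

import Mathlib

open MeasureTheory

noncomputable section

namespace ContextualBandit

variable {C A : Type*} [Fintype C] [DecidableEq C] [MeasurableSpace C] [DiscreteMeasurableSpace C]
  [Fintype A] [DecidableEq A] [MeasurableSpace A] [DiscreteMeasurableSpace A]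

/-- A tabular contextual bandit with context set `C` and action set `A`: a context distribution
and, for each context-action pair, a reward distribution supported in `[0, 1]`. -/
structure Instance (C A : Type*) [MeasurableSpace C] where
  /-- the distribution of the contexts -/
  ctx : Measure C
  /-- the reward distributions -/
  reward : C → A → Measure ℝ
  prob_ctx : IsProbabilityMeasure ctx
  prob_reward : ∀ c a, IsProbabilityMeasure (reward c a)
  reward_mem : ∀ c a, ∀ᵐ x ∂(reward c a), x ∈ Set.Icc (0 : ℝ) 1

attribute [instance] Instance.prob_ctx Instance.prob_reward

/-! ### Policies, values, gaps -/

/-- The (possibly randomized) policy, as a matrix of action probabilities, that a deterministic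
policy `π : C → A` stands for. -/
def ofDet (π : C → A) (c : C) (a : A) : ℝ := if π c = a then 1 else 0

namespace Instance

variable (M : Instance C A)

/-- The context-action visitation vector of the policy which plays `a` in context `c` with
probability `p c a`. -/
def phi (p : C → A → ℝ) (c : C) (a : A) : ℝ := M.ctx.real {c} * p c a

/-- The mean reward of a context-action pair. -/
def meanReward (c : C) (a : A) : ℝ := ∫ x, x ∂(M.reward c a)

/-- The value of a deterministic policy. -/
def value (π : C → A) : ℝ := ∑ c, ∑ a, M.phi (ofDet π) c a * M.meanReward c a

/-- `π` is an optimal policy of the class `Pi`. -/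
def IsOptimal (Pi : Finset (C → A)) (π : C → A) : Prop :=
  π ∈ Pi ∧ ∀ π' ∈ Pi, M.value π' ≤ M.value π

/-- The minimal gap of the class `Pi`, where `πs` is an optimal policy of `Pi`. If there is another
optimal policy in `Pi`, then this is `0`, whatever the choice of `πs`. -/
def gapMin (Pi : Finset (C → A)) (πs : C → A) : ℝ :=
  ⨅ π : {π // π ∈ Pi.erase πs}, (M.value πs - M.value π)

/-- The gap `Δ(π) = max {V* - V^π, Δ_min}`. -/
def gap (Pi : Finset (C → A)) (πs π : C → A) : ℝ :=
  max (M.value πs - M.value π) (M.gapMin Pi πs)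

/-- `‖x‖²_{Λ(p)⁻¹} = ∑_{c,a} x(c,a)² / φ^p(c,a)`, where `Λ(p)` is the diagonal matrix with entries
`φ^p(c,a)`. Computed in `[0, ∞]`: here `0 / 0 = 0`, and `y / 0 = ∞` for `y > 0`. -/
def sqNorm (p : C → A → ℝ) (x : C → A → ℝ) : ENNReal :=
  ∑ c, ∑ a, ENNReal.ofReal (x c a ^ 2) / ENNReal.ofReal (M.phi p c a)

/-- The complexity
`inf_{π_exp} max_{π ∈ Pi} ‖φ* - φ^π‖²_{Λ(π_exp)⁻¹} / max {ε², Δ(π)²}`, the infimum being over all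
randomized exploration policies. -/
def rho (Pi : Finset (C → A)) (πs : C → A) (ε : ℝ) : ENNReal :=
  ⨅ p : C → stdSimplex ℝ A, ⨆ π ∈ Pi,
    M.sqNorm (fun c a => (p c : A → ℝ) a)
        (fun c a => M.phi (ofDet πs) c a - M.phi (ofDet π) c a)
      / ENNReal.ofReal (max (ε ^ 2) (M.gap Pi πs π ^ 2))

end Instance

/-! ### Algorithms and their interaction with an instance -/

/-- What the algorithm has seen and done in one round: the context, its own random seed, the action
it played, the reward it received. -/
abbrev Obs (C A : Type*) : Type _ := C × unitInterval × A × ℝ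

/-- An adaptive algorithm. After `t` rounds with history `h` it decides whether to stop, and, if it
stops, which policy to return. Otherwise it observes the next context and plays an action that
depends on the history, the context and a fresh random seed. -/
structure Algorithm (C A : Type*) [MeasurableSpace C] [MeasurableSpace A] where
  act : (t : ℕ) → (Fin t → Obs C A) → C → unitInterval → A
  halt : (t : ℕ) → Set (Fin t → Obs C A)
  output : (t : ℕ) → (Fin t → Obs C A) → (C → A)
  measurable_act : ∀ t, Measurable
    fun x : (Fin t → Obs C A) × C × unitInterval => act t x.1 x.2.1 x.2.2
  measurableSet_halt : ∀ t, MeasurableSet (halt t)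
  measurable_output : ∀ t, Measurable (output t)

/-- The randomness of one round: the context, the seed of the algorithm, and for every
context-action pair the reward that would be received there (only the one of the pair that occurs
is revealed). -/
abbrev Noise (C A : Type*) : Type _ := C × unitInterval × (C → A → ℝ)

/-- The law of the randomness of one round: a context from the context distribution, a uniform seed
and rewards from the reward distributions, all independent. -/
def Instance.roundLaw (M : Instance C A) : Measure (Noise C A) :=
  M.ctx.prod ((volume : Measure unitInterval).prod
    (Measure.pi fun c => Measure.pi fun a => M.reward c a))

/-- The law of the randomness of all rounds, which are independent and identically distributed. -/
def Instance.law (M : Instance C A) : Measure (ℕ → Noise C A) :=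
  Measure.infinitePi fun _ => M.roundLaw

namespace Algorithm

variable (alg : Algorithm C A)

/-- The history of the first `t` rounds (if the algorithm does not stop before). -/
def history (ω : ℕ → Noise C A) : (t : ℕ) → Fin t → Obs C A
  | 0 => Fin.elim0
  | t + 1 =>
    let h := history ω t
    let c := (ω t).1
    let u := (ω t).2.1
    let a := alg.act t h c u
    Fin.snoc (α := fun _ => Obs C A) h (c, u, a, (ω t).2.2 c a)

/-- The algorithm stops after exactly `t` rounds, that is, after collecting `t` samples. -/
def StopsAt (ω : ℕ → Noise C A) (t : ℕ) : Prop :=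
  alg.history ω t ∈ alg.halt t ∧ ∀ s < t, alg.history ω s ∉ alg.halt s

end Algorithm

/-- The sample bound
`rho * β² * log (1 / (Δ_min ∨ ε)) + C_poly / max {ε^(5/3), Δ_min^(5/3)}` with
`β = K * sqrt (log ((|C| |Pi| / κ) * (1 / (Δ_min ∨ ε))))` and
`C_poly = P (|C|, |A|, log (1/κ), log (1 / (Δ_min ∨ ε)), log |Pi|)`. If `Δ_min ∨ ε > 0`, then `rho` is
finite, since a uniform exploration policy has finite cost. -/
def sampleBound (K : ℝ) (P : MvPolynomial (Fin 5) ℝ) (M : Instance C A) (Pi : Finset (C → A))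
    (πs : C → A) (ε κ : ℝ) : ℝ :=
  let Δmin := M.gapMin Pi πs
  let S : ℝ := Fintype.card C
  let ι := Real.log (1 / max Δmin ε)
  let β := K * Real.sqrt (Real.log (S * (Pi.card : ℝ) / κ * (1 / max Δmin ε)))
  let Cpoly := MvPolynomial.eval
    ![S, (Fintype.card A : ℝ), Real.log (1 / κ), ι, Real.log (Pi.card : ℝ)] P
  (M.rho Pi πs ε).toReal * (β ^ 2 * ι)
    + Cpoly / max (ε ^ (5 / 3 : ℝ)) (Δmin ^ (5 / 3 : ℝ))

end ContextualBandit

end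

/-!
The algorithm is phased elimination. Phase `l` has an accuracy `e`, which halves from phase to phase,
and a set of active policies which contains every optimal one and whose members have gap at most `e`.
Its actions are drawn from an exploration policy `p` which is never below half the uniform one, and
the value difference of each pair of active policies is estimated by inverse propensity weights to
within `e / 4`; policies which look worse than another one by more than `e / 4` are eliminated.

*Choice of the exploration policy.* The variance of one estimate of `V^π - V^π'` is at most
`∑_{c,a} μ(c) (π(a|c) - π'(a|c))² / p(a|c)`, and its range is at most `2 |A|`. So a Bernstein bound
asks for a number of rounds of the order of `log (1/δ) (variance / e² + |A| / e)`, and the algorithm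
takes the `p` for which this is smallest. The context distribution `μ` is replaced by the empirical
frequencies of the preceding phase. These are correct up to a constant factor for all contexts but
some of total probability `O(e)`, which are ignored, provided that the preceding phase had at least
`|C| log (1/δ) / e` rounds, up to a constant. Hence not knowing `μ` costs only a lower order term.

*Sample complexity.* While the algorithm has not stopped, all active policies satisfy
`max {ε, Δ(π)} ≤ e`. So for any `p` the largest variance among pairs of active policies is at most a
constant times `e² max_π ‖φ* - φ^π‖² / max {ε², Δ(π)²}`: pass through `π*` by the triangle
inequality, and mix `p` with uniform exploration, which at most doubles the norms. Thus a phase takes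
`O(rho log (1/δ))` rounds, up to the lower order term (`Sound.len_le_rho`). There are about
`log (1 / (Δ_min ∨ ε))` phases, and the lower order terms form a geometric series of order
`1 / (Δ_min ∨ ε)`, which is smaller than the bound allows.

*Concentration.* All tests, in all phases, are handled by one supermartingale. The `potential` of a
state is the sum, over the tests of the current phase, of failure probability times exponential of
the current Bernstein exponent, plus the failure probabilities of all later phases. It is `κ` in the
beginning, does not increase in expectation during a phase, does not increase at the end of a phase in
which all tests succeed, and is at least `1` when a test fails; hence a test ever fails with
probability at most `κ` (`measure_exists_bad_le`, `measure_exists_badStates_le`).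
-/

noncomputable section

set_option linter.unusedSectionVars false

namespace ContextualBandit

/-! ### Supermartingales along Markov chains with independent noise -/

section Chain

open ProbabilityTheory

variable {N X : Type*} [MeasurableSpace N] [MeasurableSpace X]

/-- The path of the Markov chain which starts in `x₀` and moves from `x` to `step x n` when the
noise is `n`. -/
def chain (step : X → N → X) (x₀ : X) (ω : ℕ → N) : ℕ → X
  | 0 => x₀
  | t + 1 => step (chain step x₀ ω t) (ω t)

variable {step : X → N → X} (hstep : Measurable fun z : X × N => step z.1 z.2) (x₀ : X)

include hstep in
lemma measurable_chain_past (t : ℕ) :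
    Measurable[⨆ i ∈ {i | i < t}, MeasurableSpace.comap (fun ω : ℕ → N => ω i) inferInstance]
      fun ω => chain step x₀ ω t := by
  induction t with
  | zero => exact @measurable_const _ _ _ _ _
  | succ t ih =>
    have h1 := ih.mono (biSup_mono fun i (hi : i < t) => Nat.lt_succ_of_lt hi) le_rfl
    have h2 : Measurable[⨆ i ∈ {i | i < t + 1}, MeasurableSpace.comap (fun ω : ℕ → N => ω i)
        inferInstance] fun ω : ℕ → N => ω t :=
      (comap_measurable _).mono (le_iSup₂_of_le t (Nat.lt_succ_self t) le_rfl) le_rfl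
    exact hstep.comp (h1.prodMk h2)

include hstep in
lemma measurable_chain (t : ℕ) : Measurable fun ω : ℕ → N => chain step x₀ ω t := by
  refine (measurable_chain_past hstep x₀ t).mono (iSup₂_le fun i _ => ?_) le_rfl
  exact (measurable_pi_apply i).comap_le

variable (ν : Measure N) [IsProbabilityMeasure ν]

include hstep in
/-- The noise of a round is independent of the state before that round, so expectations over a
round can be taken first over the noise of that round. -/
lemma lintegral_chain_succ (t : ℕ) {f : X → ENNReal} (hf : Measurable f) :
    ∫⁻ ω, f (chain step x₀ ω (t + 1)) ∂(Measure.infinitePi fun _ : ℕ => ν)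
      = ∫⁻ ω, ∫⁻ n, f (step (chain step x₀ ω t) n) ∂ν ∂(Measure.infinitePi fun _ : ℕ => ν) := by
  set P := Measure.infinitePi fun _ : ℕ => ν
  have hind : iIndepFun (fun (i : ℕ) (ω : ℕ → N) => ω i) P :=
    iIndepFun_infinitePi (P := fun _ : ℕ => ν) (X := fun _ n => n) fun _ => measurable_id
  have h1 : Indep (⨆ i ∈ {i | i < t}, MeasurableSpace.comap (fun ω : ℕ → N => ω i) inferInstance)
      (⨆ i ∈ ({t} : Set ℕ), MeasurableSpace.comap (fun ω : ℕ → N => ω i) inferInstance) P :=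
    indep_iSup_of_disjoint (fun i => (measurable_pi_apply i).comap_le) hind (by simp)
  have h2 : IndepFun (fun ω => chain step x₀ ω t) (fun ω : ℕ → N => ω t) P := by
    refine indep_of_indep_of_le_left (indep_of_indep_of_le_right h1 ?_)
      (measurable_chain_past hstep x₀ t).comap_le
    simp
  have h3 := (indepFun_iff_map_prod_eq_prod_map_map (measurable_chain hstep x₀ t).aemeasurable
    (measurable_pi_apply t).aemeasurable).1 h2
  have h4 : P.map (fun ω => ω t) = ν := (measurePreserving_eval_infinitePi (fun _ => ν) t).map_eq
  have hg : Measurable fun z : X × N => f (step z.1 z.2) := hf.comp hstep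
  calc ∫⁻ ω, f (chain step x₀ ω (t + 1)) ∂P
      = ∫⁻ z, f (step z.1 z.2) ∂(P.map fun ω => (chain step x₀ ω t, ω t)) := by
        rw [lintegral_map hg ((measurable_chain hstep x₀ t).prodMk (measurable_pi_apply t))]
        rfl
    _ = ∫⁻ x, ∫⁻ n, f (step x n) ∂ν ∂(P.map fun ω => chain step x₀ ω t) := by
        rw [h3, h4, lintegral_prod _ hg.aemeasurable]
    _ = _ := by
        rw [lintegral_map hg.lintegral_prod_right' (measurable_chain hstep x₀ t)]

include hstep in
/-- If `Φ` is a supermartingale along a Markov chain, then its expectation stays below its initial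
value. -/
lemma lintegral_chain_le {Φ : X → ENNReal} (hΦ : Measurable Φ)
    (hsuper : ∀ x, ∫⁻ n, Φ (step x n) ∂ν ≤ Φ x) (t : ℕ) :
    ∫⁻ ω, Φ (chain step x₀ ω t) ∂(Measure.infinitePi fun _ : ℕ => ν) ≤ Φ x₀ := by
  induction t with
  | zero => simp [chain]
  | succ t ih =>
    rw [lintegral_chain_succ hstep x₀ ν t hΦ]
    exact (lintegral_mono fun ω => hsuper _).trans ih

/-- The chain `settle ∘ update`, with a flag which records whether an update has ever produced a
state in `bad`. -/
def flagStep (update : X → N → X) (settle : X → X) (bad : Set X) (z : X × Prop) (n : N) :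
    X × Prop :=
  (settle (update z.1 n), z.2 ∨ update z.1 n ∈ bad)

lemma chain_flagStep (update : X → N → X) (settle : X → X) (bad : Set X) (ω : ℕ → N) (t : ℕ) :
    chain (flagStep update settle bad) (x₀, False) ω t
      = (chain (fun x n => settle (update x n)) x₀ ω t,
        ∃ s < t, update (chain (fun x n => settle (update x n)) x₀ ω s) (ω s) ∈ bad) := by
  induction t with
  | zero => simp [chain]
  | succ t ih =>
    rw [chain, ih]
    refine Prod.ext rfl ?_
    simp only [flagStep, Nat.lt_succ_iff_lt_or_eq, eq_iff_iff]
    constructor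
    · rintro (⟨s, hs, h⟩ | h)
      exacts [⟨s, Or.inl hs, h⟩, ⟨t, Or.inr rfl, h⟩]
    · rintro ⟨s, hs | rfl, h⟩
      exacts [Or.inl ⟨s, hs, h⟩, Or.inr h]

/-- A maximal inequality of Ville type. A round of the chain consists of a random `update`, which
does not increase the expectation of the potential `Φ`, followed by a deterministic `settle`, which
does not increase `Φ` unless the updated state is `bad`. If `Φ ≥ 1` on bad states, then the
probability that a bad state is ever produced is at most the initial potential. -/
theorem measure_exists_bad_le {update : X → N → X} {settle : X → X} {bad : Set X}
    (hupdate : Measurable fun z : X × N => update z.1 z.2) (hsettle : Measurable settle)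
    (hbad : MeasurableSet bad) {Φ : X → ENNReal} (hΦ : Measurable Φ)
    (hsuper : ∀ x, ∫⁻ n, Φ (update x n) ∂ν ≤ Φ x)
    (hone : ∀ x ∈ bad, 1 ≤ Φ x) (hle : ∀ x ∉ bad, Φ (settle x) ≤ Φ x) :
    (Measure.infinitePi fun _ : ℕ => ν)
      {ω | ∃ t, update (chain (fun x n => settle (update x n)) x₀ ω t) (ω t) ∈ bad} ≤ Φ x₀ := by
  classical
  set P := Measure.infinitePi fun _ : ℕ => ν
  have hflag : Measurable fun z : (X × Prop) × N => flagStep update settle bad z.1 z.2 := by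
    have h : Measurable fun z : (X × Prop) × N => update z.1.1 z.2 :=
      hupdate.comp (measurable_fst.fst.prodMk measurable_snd)
    refine (hsettle.comp h).prodMk ?_
    refine measurableSet_setOfPred.1 ((measurableSet_setOfPred.2 measurable_fst.snd).union ?_)
    exact h hbad
  set Ψ : X × Prop → ENNReal := fun z => if z.2 then 1 else Φ z.1
  have hΨ : Measurable Ψ := Measurable.ite (measurableSet_setOfPred.2 measurable_snd)
    measurable_const (hΦ.comp measurable_fst)
  have hΨ_super : ∀ z, ∫⁻ n, Ψ (flagStep update settle bad z n) ∂ν ≤ Ψ z := by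
    rintro ⟨x, b⟩
    by_cases hb : b
    · simp [Ψ, flagStep, hb]
    · refine (lintegral_mono fun n => ?_).trans ((hsuper x).trans_eq (by simp [Ψ, hb]))
      by_cases hx : update x n ∈ bad
      · simpa [Ψ, flagStep, hb, hx] using hone _ hx
      · simpa [Ψ, flagStep, hb, hx] using hle _ hx
  have key : ∀ t, P {ω | ∃ s < t,
      update (chain (fun x n => settle (update x n)) x₀ ω s) (ω s) ∈ bad} ≤ Φ x₀ := by
    intro t
    have hm : Measurable fun ω => chain (flagStep update settle bad) (x₀, False) ω t :=
      measurable_chain hflag _ t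
    have h := lintegral_chain_le hflag (x₀, False) ν hΨ hΨ_super t
    simp only [Ψ, if_false] at h
    refine le_trans ?_ h
    rw [← lintegral_indicator_one]
    · refine lintegral_mono fun ω => ?_
      rw [chain_flagStep]
      by_cases hω : ∃ s < t,
        update (chain (fun x n => settle (update x n)) x₀ ω s) (ω s) ∈ bad
      · rw [Set.indicator_of_mem (by exact hω), if_pos hω]; rfl
      · rw [Set.indicator_of_notMem (by exact hω)]; exact zero_le
    · simp_rw [chain_flagStep] at hm
      exact measurableSet_setOfPred.2 hm.snd
  have hU : {ω | ∃ t, update (chain (fun x n => settle (update x n)) x₀ ω t) (ω t) ∈ bad}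
      = ⋃ t, {ω | ∃ s < t,
        update (chain (fun x n => settle (update x n)) x₀ ω s) (ω s) ∈ bad} := by
    ext ω
    simp only [Set.mem_ofPred_eq, Set.mem_iUnion]
    exact ⟨fun ⟨t, h⟩ => ⟨t + 1, t, Nat.lt_succ_self t, h⟩, fun ⟨_, s, _, h⟩ => ⟨s, h⟩⟩
  rw [hU, Monotone.measure_iUnion]
  · exact iSup_le key
  · exact fun a b hab ω ⟨s, hs, h⟩ => ⟨s, hs.trans_le hab, h⟩

end Chain

variable {C A : Type*} [Fintype C] [DecidableEq C] [MeasurableSpace C] [DiscreteMeasurableSpace C]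
  [Fintype A] [DecidableEq A] [MeasurableSpace A] [DiscreteMeasurableSpace A]

/-! ### The randomness of a round -/

section Round

/-- A distribution on a finite set, given by its vector of probabilities, is the law of a function
of a uniform seed. -/
lemma exists_measurable_sampler [Nonempty A] (q : stdSimplex ℝ A) :
    ∃ f : unitInterval → A, Measurable f ∧
      ∀ a, volume (f ⁻¹' {a}) = ENNReal.ofReal (q a) := by
  have hsum : ∑ a, ENNReal.ofReal (q a) = 1 := by
    rw [← ENNReal.ofReal_sum_of_nonneg fun a _ => stdSimplex.zero_le q a, stdSimplex.sum_eq_one q,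
      ENNReal.ofReal_one]
  set μ : Measure A := (PMF.ofFintype (fun a => ENNReal.ofReal (q a)) hsum).toMeasure
  obtain ⟨f, hf, hμ⟩ := μ.exists_measurable_map_eq
  refine ⟨f, hf, fun a => ?_⟩
  rw [← Measure.map_apply hf (measurableSet_singleton a), hμ,
    PMF.toMeasure_apply_singleton _ _ (measurableSet_singleton a)]
  rfl

/-- A function of a uniform seed which has the distribution `q` on the actions. -/
def sampler [Nonempty A] (q : stdSimplex ℝ A) : unitInterval → A :=
  (exists_measurable_sampler q).choose

lemma measurable_sampler [Nonempty A] (q : stdSimplex ℝ A) : Measurable (sampler q) :=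
  (exists_measurable_sampler q).choose_spec.1

lemma volume_sampler_preimage [Nonempty A] (q : stdSimplex ℝ A) (a : A) :
    volume (sampler q ⁻¹' {a}) = ENNReal.ofReal (q a) :=
  (exists_measurable_sampler q).choose_spec.2 a

variable (M : Instance C A)

/-- The reward, clipped to `[0, 1]`. -/
def clip (x : ℝ) : ℝ := max 0 (min 1 x)

lemma measurable_clip : Measurable clip := by unfold clip; fun_prop

lemma clip_mem (x : ℝ) : 0 ≤ clip x ∧ clip x ≤ 1 := by simp [clip]

lemma integrable_clip (c : C) (a : A) : Integrable clip (M.reward c a) :=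
  Integrable.of_bound measurable_clip.aestronglyMeasurable 1
    (Filter.Eventually.of_forall fun x => by
      rw [Real.norm_eq_abs, abs_of_nonneg (clip_mem x).1]; exact (clip_mem x).2)

lemma integral_clip (c : C) (a : A) : ∫ x, clip x ∂M.reward c a = M.meanReward c a := by
  refine integral_congr_ae ?_
  filter_upwards [M.reward_mem c a] with x hx
  simp [clip, hx.1, hx.2]

lemma meanReward_mem (c : C) (a : A) : 0 ≤ M.meanReward c a ∧ M.meanReward c a ≤ 1 := by
  rw [← integral_clip]
  refine ⟨integral_nonneg fun x => (clip_mem x).1, ?_⟩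
  calc ∫ x, clip x ∂M.reward c a ≤ ∫ _, 1 ∂M.reward c a :=
        integral_mono (integrable_clip M c a) (integrable_const 1) fun x => (clip_mem x).2
    _ = 1 := by simp

lemma sum_ctx_real : ∑ c, M.ctx.real {c} = 1 := by
  simp

lemma exp_le_one_add_add_sq {x : ℝ} (hx : |x| ≤ 1) : Real.exp x ≤ 1 + x + x ^ 2 := by
  have := (abs_le.1 (Real.abs_exp_sub_one_sub_id_le hx)).2
  linarith

variable [Nonempty A] (p : C → stdSimplex ℝ A)

/-- The law of context, action and reward in a round in which the actions are drawn from `p`. -/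
lemma lintegral_roundLaw {g : C → A → ℝ → ENNReal} (hg : ∀ c a, Measurable (g c a)) :
    ∫⁻ n, g n.1 (sampler (p n.1) n.2.1) (n.2.2 n.1 (sampler (p n.1) n.2.1)) ∂M.roundLaw
      = ∑ c, ∑ a, M.ctx {c} * ENNReal.ofReal (p c a) * ∫⁻ x, g c a x ∂M.reward c a := by
  have hgm : Measurable fun z : (C × A) × ℝ => g z.1.1 z.1.2 z.2 :=
    measurable_from_prod_countable_right fun ca => hg ca.1 ca.2
  have hs : Measurable fun z : C × unitInterval => sampler (p z.1) z.2 :=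
    measurable_from_prod_countable_right fun c => measurable_sampler (p c)
  have heval : Measurable fun z : (C × A) × (C → A → ℝ) => z.2 z.1.1 z.1.2 :=
    measurable_from_prod_countable_right fun ca =>
      (measurable_pi_apply ca.2).comp (measurable_pi_apply ca.1)
  have hca : Measurable fun n : Noise C A => (n.1, sampler (p n.1) n.2.1) :=
    measurable_fst.prodMk (hs.comp (measurable_fst.prodMk measurable_snd.fst))
  have hmeas : Measurable fun n : Noise C A =>
      g n.1 (sampler (p n.1) n.2.1) (n.2.2 n.1 (sampler (p n.1) n.2.1)) :=
    hgm.comp (hca.prodMk (heval.comp (hca.prodMk measurable_snd.snd)))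
  have hinner : ∀ c a, ∫⁻ f, g c a (f c a) ∂(Measure.pi fun c => Measure.pi fun a => M.reward c a)
      = ∫⁻ x, g c a x ∂M.reward c a := by
    intro c a
    have h1 := measurePreserving_eval (fun c => Measure.pi fun a => M.reward c a) c
    have h2 := measurePreserving_eval (fun a => M.reward c a) a
    exact (h2.comp h1).lintegral_comp (hg c a)
  rw [Instance.roundLaw, lintegral_prod _ hmeas.aemeasurable, lintegral_fintype]
  refine Finset.sum_congr rfl fun c _ => ?_
  rw [lintegral_prod (fun y : unitInterval × (C → A → ℝ) => g c (sampler (p c) y.1)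
    (y.2 c (sampler (p c) y.1)))
    (hmeas.comp (measurable_const (a := c).prodMk measurable_id)).aemeasurable]
  simp only [hinner]
  have hmap := lintegral_map (μ := (volume : Measure unitInterval))
    (f := fun a => ∫⁻ x, g c a x ∂M.reward c a) (Measurable.of_discrete) (measurable_sampler (p c))
  rw [← hmap, lintegral_fintype, Finset.sum_mul]
  refine Finset.sum_congr rfl fun a _ => ?_
  rw [Measure.map_apply (measurable_sampler _) (measurableSet_singleton a),
    volume_sampler_preimage]
  ring

/-- The exponential moment bound behind Bernstein's inequality, for a quantity which depends on
context and action and is affine in the clipped reward: `E exp Z ≤ exp (E Z + E Z²)` if `|Z| ≤ 1`,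
with the second moment replaced by an upper bound. -/
lemma lintegral_exp_roundLaw_le {x y : C → A → ℝ} (hx : ∀ c a, |y c a| + |x c a| ≤ 1) {b : ℝ}
    (hb : ∑ c, ∑ a, M.ctx.real {c} * p c a *
      (y c a + x c a * M.meanReward c a + (|y c a| + |x c a|) ^ 2) ≤ b) :
    ∫⁻ n, ENNReal.ofReal (Real.exp (y n.1 (sampler (p n.1) n.2.1)
        + x n.1 (sampler (p n.1) n.2.1) * clip (n.2.2 n.1 (sampler (p n.1) n.2.1)) - b))
      ∂M.roundLaw ≤ 1 := by
  have hp0 : ∀ c a, 0 ≤ p c a := fun c a => (p c).2.1 a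
  have hg : ∀ c a, Measurable fun r => ENNReal.ofReal (Real.exp (y c a + x c a * clip r - b)) :=
    fun c a => ENNReal.measurable_ofReal.comp (Real.measurable_exp.comp
      (((measurable_clip.const_mul _).const_add _).sub_const _))
  rw [lintegral_roundLaw M p (g := fun c a r =>
    ENNReal.ofReal (Real.exp (y c a + x c a * clip r - b))) hg]
  set w : C → A → ℝ := fun c a =>
    1 + (y c a + x c a * M.meanReward c a + (|y c a| + |x c a|) ^ 2)
  have habs : ∀ c a r, |y c a + x c a * clip r| ≤ |y c a| + |x c a| := by
    intro c a r
    refine (abs_add_le _ _).trans ?_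
    rw [abs_mul, abs_of_nonneg (clip_mem r).1]
    have := mul_le_mul_of_nonneg_left (clip_mem r).2 (abs_nonneg (x c a))
    linarith
  have hpt : ∀ c a r, Real.exp (y c a + x c a * clip r)
      ≤ 1 + (y c a + (|y c a| + |x c a|) ^ 2) + x c a * clip r := by
    intro c a r
    have h1 := exp_le_one_add_add_sq ((habs c a r).trans (hx c a))
    have h2 : (y c a + x c a * clip r) ^ 2 ≤ (|y c a| + |x c a|) ^ 2 := by
      rw [← sq_abs (y c a + _)]
      exact pow_le_pow_left₀ (abs_nonneg _) (habs c a r) 2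
    linarith
  have hint : ∀ c a, Integrable
      (fun r => 1 + (y c a + (|y c a| + |x c a|) ^ 2) + x c a * clip r) (M.reward c a) :=
    fun c a => (integrable_const _).add ((integrable_clip M c a).const_mul _)
  have hpos : ∀ c a r, 0 ≤ 1 + (y c a + (|y c a| + |x c a|) ^ 2) + x c a * clip r :=
    fun c a r => (Real.exp_pos _).le.trans (hpt c a r)
  have hw_int : ∀ c a, ∫ r, 1 + (y c a + (|y c a| + |x c a|) ^ 2) + x c a * clip r ∂M.reward c a
      = w c a := by
    intro c a
    rw [integral_add (integrable_const _) ((integrable_clip M c a).const_mul _),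
      integral_const_mul, integral_clip]
    simp [w]; ring
  have hw0 : ∀ c a, 0 ≤ w c a := fun c a => by
    rw [← hw_int]; exact integral_nonneg (hpos c a)
  have hle : ∀ c a, ∫⁻ r, ENNReal.ofReal (Real.exp (y c a + x c a * clip r - b)) ∂M.reward c a
      ≤ ENNReal.ofReal (Real.exp (-b) * w c a) := by
    intro c a
    calc ∫⁻ r, ENNReal.ofReal (Real.exp (y c a + x c a * clip r - b)) ∂M.reward c a
        ≤ ∫⁻ r, ENNReal.ofReal (Real.exp (-b) *
          (1 + (y c a + (|y c a| + |x c a|) ^ 2) + x c a * clip r)) ∂M.reward c a := by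
          refine lintegral_mono fun r => ENNReal.ofReal_le_ofReal ?_
          rw [sub_eq_neg_add, Real.exp_add]
          exact mul_le_mul_of_nonneg_left (hpt c a r) (Real.exp_pos _).le
      _ = ENNReal.ofReal (Real.exp (-b) * w c a) := by
          rw [← ofReal_integral_eq_lintegral_ofReal ((hint c a).const_mul _)
            (Filter.Eventually.of_forall fun r => mul_nonneg (Real.exp_pos _).le (hpos c a r)),
            integral_const_mul, hw_int]
  have hctx : ∀ c, M.ctx {c} = ENNReal.ofReal (M.ctx.real {c}) := fun c => by
    simp [Measure.real]
  calc _ ≤ ∑ c, ∑ a, ENNReal.ofReal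
        (M.ctx.real {c} * p c a * (Real.exp (-b) * w c a)) := by
        refine Finset.sum_le_sum fun c _ => Finset.sum_le_sum fun a _ => ?_
        rw [hctx, ← ENNReal.ofReal_mul measureReal_nonneg,
          ENNReal.ofReal_mul (mul_nonneg measureReal_nonneg (hp0 c a))]
        gcongr
        exact hle c a
    _ = ENNReal.ofReal (∑ c, ∑ a, M.ctx.real {c} * p c a * (Real.exp (-b) * w c a)) := by
        have h0 : ∀ c a, 0 ≤ M.ctx.real {c} * p c a * (Real.exp (-b) * w c a) :=
          fun c a => mul_nonneg (mul_nonneg measureReal_nonneg (hp0 c a))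
            (mul_nonneg (Real.exp_pos _).le (hw0 c a))
        rw [ENNReal.ofReal_sum_of_nonneg fun c _ => Finset.sum_nonneg fun a _ => h0 c a]
        exact Finset.sum_congr rfl fun c _ =>
          (ENNReal.ofReal_sum_of_nonneg fun a _ => h0 c a).symm
    _ ≤ 1 := by
        rw [ENNReal.ofReal_le_one]
        have hsum1 : ∑ c, ∑ a, M.ctx.real {c} * p c a = 1 := by
          simp_rw [← Finset.mul_sum, fun c => stdSimplex.sum_eq_one (p c), mul_one]
          exact sum_ctx_real M
        have : ∑ c, ∑ a, M.ctx.real {c} * p c a * (Real.exp (-b) * w c a)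
            = Real.exp (-b) * (1 + ∑ c, ∑ a, M.ctx.real {c} * p c a *
              (y c a + x c a * M.meanReward c a + (|y c a| + |x c a|) ^ 2)) := by
          rw [← hsum1, ← Finset.sum_add_distrib, Finset.mul_sum]
          refine Finset.sum_congr rfl fun c _ => ?_
          rw [← Finset.sum_add_distrib, Finset.mul_sum]
          refine Finset.sum_congr rfl fun a _ => ?_
          simp only [w]; ring
        rw [this]
        calc _ ≤ Real.exp (-b) * Real.exp b := by
              gcongr
              linarith [Real.add_one_le_exp b]
          _ = 1 := by rw [← Real.exp_add]; simp

end Round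

/-! ### The elimination algorithm -/

/-- The number of concentration tests that a phase has to pass: two for each context and one for
each ordered pair of policies. -/
def numTests (Pi : Finset (C → A)) : ℝ := 2 * Fintype.card C + (Pi.card : ℝ) ^ 2

/-- The failure probability granted to each test of phase `l`. -/
def errProb (Pi : Finset (C → A)) (κ : ℝ) (l : ℕ) : ℝ := κ / (2 ^ (l + 1) * numTests Pi)

/-- The logarithm of the inverse failure probability of a test of phase `l`. -/
def logTerm (Pi : Finset (C → A)) (κ : ℝ) (l : ℕ) : ℝ := Real.log (2 ^ (l + 1) * numTests Pi / κ)

/-- The bound on the gaps of the policies which are active in phase `l`. The truncated subtraction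
makes it `1`, which bounds every gap, in both of the phases `0` and `1`: phase `0` serves only to
collect contexts. -/
def accuracy (l : ℕ) : ℝ := (1 / 2) ^ (l - 1)

/-- The data which fix how a phase is run: its index, the policies not yet eliminated, and the
context counts and the length of the preceding phase. -/
structure Phase (C A : Type*) where
  index : ℕ
  active : Finset (C → A)
  prevCount : C → ℕ
  prevLen : ℕ

/-- The discrete part of the state of the algorithm: the current phase, the number of rounds it has
lasted, and how often each context has occurred in it. -/
structure Control (C A : Type*) where
  phase : Phase C A
  elapsed : ℕ
  count : C → ℕ

instance : Countable (Control C A) :=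
  Function.Injective.countable (f := fun z : Control C A =>
    (z.phase.index, z.phase.active, z.phase.prevCount, z.phase.prevLen, z.elapsed, z.count)) <| by
    rintro ⟨⟨a, b, c, d⟩, e, f⟩ ⟨⟨a', b', c', d'⟩, e', f'⟩ h
    simp only [Prod.mk.injEq] at h
    obtain ⟨rfl, rfl, rfl, rfl, rfl, rfl⟩ := h
    rfl

instance : MeasurableSpace (Control C A) := ⊤

/-- The state of the algorithm: the discrete part, and for each policy the sum, over the current
phase, of its inverse propensity estimates. -/
abbrev State (C A : Type*) : Type _ := Control C A × ((C → A) → ℝ)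

/-- The difference of the action probabilities of two deterministic policies. -/
def diff (π π' : C → A) (c : C) (a : A) : ℝ := ofDet π c a - ofDet π' c a

/-- `∑_{c,a} w(c) x(c,a)² / p(a | c)`. -/
def weightedSq (w : C → ℝ) (p : C → A → ℝ) (x : C → A → ℝ) : ℝ :=
  ∑ c, ∑ a, w c * x c a ^ 2 / p c a

section Parameters

variable (Pi : Finset (C → A)) (κ : ℝ)

/-- The contexts which occurred so often in the preceding phase that their frequency determines
their probability up to a constant factor. The others are ignored. -/
def reliable (P : Phase C A) : Finset C :=
  Finset.univ.filter fun c => 4 * logTerm Pi κ P.index ≤ P.prevCount c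

/-- The empirical frequencies of the reliable contexts in the preceding phase. -/
def freq (P : Phase C A) (c : C) : ℝ :=
  if c ∈ reliable Pi κ P then (P.prevCount c : ℝ) / P.prevLen else 0

/-- In `n` rounds of exploration with `p`, the value differences of all pairs of active policies can
be estimated to a fixed fraction of the accuracy of the phase (as far as the frequencies of the
reliable contexts can be trusted), and `n` rounds give sufficiently many contexts for the next
phase. The constants are those for which the estimates have error at most an eighth of the accuracy
(`estimate_le`) and the unreliable contexts of the next phase have total probability at most an eighth
of its accuracy (`Calibrated.unreliable_le`). -/
def Feasible (P : Phase C A) (n : ℕ) (p : C → stdSimplex ℝ A) : Prop :=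
  (∀ c a, 1 / (2 * (Fintype.card A : ℝ)) ≤ p c a) ∧
    ∀ π ∈ P.active, ∀ π' ∈ P.active,
      1536 * logTerm Pi κ (P.index + 1) * weightedSq (freq Pi κ P) (fun c => p c) (diff π π')
          + (64 * Fintype.card A + 192 * Fintype.card C) * logTerm Pi κ (P.index + 1)
            * accuracy P.index
        ≤ n * accuracy P.index ^ 2

/-- The length of a phase: the least number of rounds for which a feasible exploration policy
exists. -/
def len (P : Phase C A) : ℕ := sInf {n | ∃ p, Feasible Pi κ P n p}

open Classical in
/-- The exploration policy of a phase: a feasible one, which exists by `exists_feasible`. -/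
def explore [Nonempty A] (P : Phase C A) : C → stdSimplex ℝ A :=
  if h : ∃ p, Feasible Pi κ P (len Pi κ P) p then h.choose else fun _ => stdSimplex.barycenter

/-- The factor which a reward gets in the inverse propensity estimate of the policy `π`. -/
def ipsWeight [Nonempty A] (P : Phase C A) (π : C → A) (c : C) (a : A) : ℝ :=
  if c ∈ reliable Pi κ P then ofDet π c a / explore Pi κ P c a else 0

/-- The discrete part of the state after a round in which the context `c` occurred. -/
def updateControl (z : Control C A) (c : C) : Control C A :=
  ⟨z.phase, z.elapsed + 1, fun c' => z.count c' + if c = c' then 1 else 0⟩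

/-- The state after an observation, before a possible change of phase. -/
def update [Nonempty A] (z : State C A) (o : Obs C A) : State C A :=
  (updateControl z.1 o.1, fun π => z.2 π + ipsWeight Pi κ z.1.phase π o.1 o.2.2.1 * clip o.2.2.2)

open Classical in
/-- The start of the next phase, if the policy `π` survives when `beats π' π` fails for all active
`π'`. -/
def nextControl (z : Control C A) (beats : (C → A) → (C → A) → Prop) : Control C A :=
  ⟨⟨z.phase.index + 1, z.phase.active.filter fun π => ∀ π' ∈ z.phase.active, ¬ beats π' π,
    z.count, z.elapsed⟩, 0, 0⟩

/-- `π'` has a larger estimated value than `π`, by more than a quarter of the accuracy. -/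
def Beats (z : State C A) (π' π : C → A) : Prop :=
  z.1.elapsed * (accuracy z.1.phase.index / 4) < z.2 π' - z.2 π

open Classical in
/-- Passage to the next phase, if the current one is complete. -/
def settle (z : State C A) : State C A :=
  if z.1.elapsed < len Pi κ z.1.phase then z else (nextControl z.1 (Beats z), 0)

/-- The initial state. -/
def initState : State C A := (⟨⟨0, Pi, 0, 0⟩, 0, 0⟩, 0)

/-- The state reached after a history. -/
def stateOf [Nonempty A] : (t : ℕ) → (Fin t → Obs C A) → State C A
  | 0, _ => initState Pi
  | t + 1, h => settle Pi κ (update Pi κ (stateOf t (Fin.init h)) (h (Fin.last t)))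

/-- The algorithm stops when a single policy is left, or when all policies which are left are
accurate enough. -/
def Halted (ε : ℝ) (z : Control C A) : Prop :=
  z.phase.active.card ≤ 1 ∨ accuracy z.phase.index ≤ ε

open Classical in
/-- Some policy of a finite set. -/
def pick [Nonempty A] (s : Finset (C → A)) : C → A :=
  if h : s.Nonempty then h.choose else Classical.arbitrary _

lemma pick_mem [Nonempty A] {s : Finset (C → A)} (h : s.Nonempty) : pick s ∈ s := by
  rw [pick, dif_pos h]
  exact h.choose_spec

lemma measurable_updateControl : Measurable fun x : Control C A × C => updateControl x.1 x.2 :=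
  .of_discrete
lemma measurable_ipsWeight [Nonempty A] (π : C → A) :
    Measurable fun x : Control C A × C × A => ipsWeight Pi κ x.1.phase π x.2.1 x.2.2 :=
  .of_discrete

lemma measurable_update [Nonempty A] :
    Measurable fun z : State C A × Obs C A => update Pi κ z.1 z.2 := by
  have h1 : Measurable fun z : State C A × Obs C A => (z.1.1, z.2.1) := by fun_prop
  have h2 : Measurable fun z : State C A × Obs C A => (z.1.1, z.2.1, z.2.2.2.1) := by fun_prop
  have h3 : Measurable fun z : State C A × Obs C A => z.1.2 := by fun_prop
  have h4 : Measurable fun z : State C A × Obs C A => clip z.2.2.2.2 :=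
    measurable_clip.comp (by fun_prop)
  have h5 := measurable_updateControl.comp h1
  have h6 : Measurable fun z : State C A × Obs C A => fun π =>
      z.1.2 π + ipsWeight Pi κ z.1.1.phase π z.2.1 z.2.2.2.1 * clip z.2.2.2.2 := by
    refine measurable_pi_lambda _ fun π => ?_
    have := (measurable_ipsWeight Pi κ π).comp h2
    exact ((measurable_pi_apply π).comp h3).add (this.mul h4)
  exact h5.prodMk h6

lemma measurable_settle : Measurable (settle Pi κ : State C A → State C A) := by
  classical
  refine Measurable.ite ?_ measurable_id (Measurable.prodMk ?_ measurable_const)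
  · exact measurable_fst (MeasurableSet.of_discrete
      (s := {z : Control C A | z.elapsed < len Pi κ z.phase}))
  · have hb : Measurable fun z : State C A => Beats z := by
      refine measurable_pi_lambda _ fun π' => measurable_pi_lambda _ fun π => ?_
      refine measurableSet_setOfPred.1 (measurableSet_lt ?_ ?_)
      · exact (Measurable.of_discrete (f := fun z : Control C A =>
          (z.elapsed : ℝ) * (accuracy z.phase.index / 4))).comp measurable_fst
      · exact ((measurable_pi_apply π').comp measurable_snd).sub
          ((measurable_pi_apply π).comp measurable_snd)
    exact (Measurable.of_discrete (f := fun x : Control C A × ((C → A) → (C → A) → Prop) =>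
      nextControl x.1 x.2)).comp (measurable_fst.prodMk hb)

lemma measurable_stateOf [Nonempty A] (t : ℕ) :
    Measurable (stateOf Pi κ t : (Fin t → Obs C A) → State C A) := by
  induction t with
  | zero => exact measurable_const
  | succ t ih =>
    refine (measurable_settle Pi κ).comp ((measurable_update Pi κ).comp
      (Measurable.prodMk (ih.comp ?_) (measurable_pi_apply _)))
    exact measurable_pi_lambda _ fun i => measurable_pi_apply _

lemma measurable_sampler_explore [Nonempty A] :
    Measurable fun x : (Control C A × C) × unitInterval =>
      sampler (explore Pi κ x.1.1.phase x.1.2) x.2 :=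
  measurable_from_prod_countable_right fun x => measurable_sampler (explore Pi κ x.1.phase x.2)

lemma measurable_sample [Nonempty A] {Y : Type*} [MeasurableSpace Y] {f : Y → Control C A} {g : Y → C}
    {u : Y → unitInterval} (hf : Measurable f) (hg : Measurable g) (hu : Measurable u) :
    Measurable fun y => sampler (explore Pi κ (f y).phase (g y)) (u y) := by
  have h := (hf.prodMk hg).prodMk hu
  have h2 := (measurable_sampler_explore Pi κ).comp h
  exact h2

/-- Phased elimination. -/
def elimination [Nonempty A] (ε : ℝ) : Algorithm C A where
  act t h c u := sampler (explore Pi κ (stateOf Pi κ t h).1.phase c) u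
  halt t := {h | Halted ε (stateOf Pi κ t h).1}
  output t h := pick (stateOf Pi κ t h).1.phase.active
  measurable_act t := by
    have h1 := (measurable_stateOf Pi κ t).fst
    exact measurable_sample Pi κ (h1.comp measurable_fst) measurable_snd.fst measurable_snd.snd
  measurableSet_halt t := by
    have h : MeasurableSet {z : Control C A | Halted ε z} := .of_discrete
    exact (measurable_stateOf Pi κ t).fst h
  measurable_output t := by
    have h : Measurable fun z : Control C A => pick z.phase.active := .of_discrete
    exact h.comp (measurable_stateOf Pi κ t).fst

/-- The update of the state, as a function of the randomness of the round. -/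
def noisyUpdate [Nonempty A] (z : State C A) (n : Noise C A) : State C A :=
  let a := sampler (explore Pi κ z.1.phase n.1) n.2.1
  update Pi κ z (n.1, n.2.1, a, n.2.2 n.1 a)

lemma measurable_noisyUpdate [Nonempty A] :
    Measurable fun z : State C A × Noise C A => noisyUpdate Pi κ z.1 z.2 := by
  have h1 : Measurable fun z : State C A × Noise C A => z.1.1 := by fun_prop
  have heval : Measurable fun z : (C × A) × (C → A → ℝ) => z.2 z.1.1 z.1.2 :=
    measurable_from_prod_countable_right fun ca =>
      (measurable_pi_apply ca.2).comp (measurable_pi_apply ca.1)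
  have h3 : Measurable fun z : State C A × Noise C A => z.2.1 := by fun_prop
  have h4 : Measurable fun z : State C A × Noise C A => z.2.2.1 := by fun_prop
  have h2 := measurable_sample Pi κ h1 h3 h4
  have h5 : Measurable fun z : State C A × Noise C A => z.2.2.2 := by fun_prop
  have h6 := heval.comp ((h3.prodMk h2).prodMk h5)
  have h7 : Measurable fun z : State C A × Noise C A => z.1 := measurable_fst
  have h8 := (measurable_update Pi κ).comp (h7.prodMk (h3.prodMk (h4.prodMk (h2.prodMk h6))))
  exact h8

/-- The sequence of states of the algorithm. -/
abbrev path [Nonempty A] (ω : ℕ → Noise C A) : ℕ → State C A :=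
  chain (fun z n => settle Pi κ (noisyUpdate Pi κ z n)) (initState Pi) ω

lemma stateOf_history [Nonempty A] (ε : ℝ) (ω : ℕ → Noise C A) (t : ℕ) :
    stateOf Pi κ t ((elimination Pi κ ε).history ω t) = path Pi κ ω t := by
  induction t with
  | zero => rfl
  | succ t ih =>
    rw [path, chain, ← path, ← ih]
    simp [stateOf, Algorithm.history, noisyUpdate, elimination]

end Parameters

/-! ### Concentration -/

lemma accuracy_pos (l : ℕ) : 0 < accuracy l := by unfold accuracy; positivity

lemma abs_diff_le (π π' : C → A) (c : C) (a : A) : |diff π π' c a| ≤ 1 := by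
  unfold diff ofDet
  split_ifs <;> norm_num

section Feasibility

variable (Pi : Finset (C → A)) (κ : ℝ) [Nonempty A]

lemma card_pos_real : 0 < (Fintype.card A : ℝ) := by exact_mod_cast Fintype.card_pos

lemma half_inv_card_le : 1 / (2 * (Fintype.card A : ℝ)) ≤ (Fintype.card A : ℝ)⁻¹ := by
  rw [one_div]
  exact inv_anti₀ card_pos_real (by linarith [card_pos_real (A := A)])

lemma exists_feasible (P : Phase C A) : ∃ n p, Feasible Pi κ P n p := by
  have h : ∀ᶠ n : ℕ in Filter.atTop, ∀ π ∈ P.active, ∀ π' ∈ P.active,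
      1536 * logTerm Pi κ (P.index + 1) * weightedSq (freq Pi κ P)
        (fun c => (stdSimplex.barycenter : stdSimplex ℝ A)) (diff π π')
          + (64 * Fintype.card A + 192 * Fintype.card C) * logTerm Pi κ (P.index + 1)
            * accuracy P.index
        ≤ n * accuracy P.index ^ 2 := by
    refine (Finset.eventually_all _).2 fun π _ => (Finset.eventually_all _).2 fun π' _ => ?_
    exact (tendsto_natCast_atTop_atTop.atTop_mul_const
      (pow_pos (accuracy_pos P.index) 2)).eventually_ge_atTop _
  obtain ⟨n, hn⟩ := h.exists
  exact ⟨n, fun _ => stdSimplex.barycenter, fun c a => half_inv_card_le, hn⟩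

lemma feasible_explore (P : Phase C A) : Feasible Pi κ P (len Pi κ P) (explore Pi κ P) := by
  have h : ∃ p, Feasible Pi κ P (len Pi κ P) p :=
    Nat.sInf_mem (s := {n | ∃ p, Feasible Pi κ P n p}) (exists_feasible Pi κ P)
  rw [explore, dif_pos h]
  exact h.choose_spec

lemma le_explore (P : Phase C A) (c : C) (a : A) :
    1 / (2 * (Fintype.card A : ℝ)) ≤ explore Pi κ P c a :=
  (feasible_explore Pi κ P).1 c a

lemma explore_pos (P : Phase C A) (c : C) (a : A) : 0 < explore Pi κ P c a :=
  (by have := card_pos_real (A := A); positivity : 0 < 1 / (2 * (Fintype.card A : ℝ))).trans_le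
    (le_explore Pi κ P c a)

lemma freq_nonneg (P : Phase C A) (c : C) : 0 ≤ freq Pi κ P c := by
  unfold freq
  split_ifs <;> positivity

lemma weightedSq_nonneg {w : C → ℝ} (hw : ∀ c, 0 ≤ w c) {p : C → A → ℝ} (hp : ∀ c a, 0 ≤ p c a)
    (x : C → A → ℝ) : 0 ≤ weightedSq w p x :=
  Finset.sum_nonneg fun c _ => Finset.sum_nonneg fun a _ =>
    div_nonneg (mul_nonneg (hw c) (sq_nonneg _)) (hp c a)

end Feasibility

section Potential

variable (Pi : Finset (C → A)) (κ : ℝ) [Nonempty A] (M : Instance C A)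

/-- The probabilities of the reliable contexts. -/
def trueFreq (P : Phase C A) (c : C) : ℝ := if c ∈ reliable Pi κ P then M.ctx.real {c} else 0

/-- The part of the value difference `V^π - V^π'` which is due to the reliable contexts. -/
def reliableDiff (P : Phase C A) (π π' : C → A) : ℝ :=
  ∑ c, ∑ a, trueFreq Pi κ M P c * diff π π' c a * M.meanReward c a

/-- The empirical counterpart, known to the algorithm, of the variance of the estimate of
`V^π - V^π'` in one round. -/
def estVar (P : Phase C A) (π π' : C → A) : ℝ :=
  weightedSq (freq Pi κ P) (fun c => explore Pi κ P c) (diff π π')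

/-- A bound on the variance of the estimate of `V^π - V^π'` in one round. -/
def trueVar (P : Phase C A) (π π' : C → A) : ℝ :=
  weightedSq (trueFreq Pi κ M P) (fun c => explore Pi κ P c) (diff π π')

/-- The scale at which exponential moments are taken. It is at most `1 / (2 |A|)`, since a single
estimate is bounded by `2 |A|`, and otherwise of the order of accuracy over variance. -/
def scale (P : Phase C A) (π π' : C → A) : ℝ :=
  1 / (2 * Fintype.card A + 48 * estVar Pi κ P π π' / accuracy P.index)

lemma estVar_nonneg (P : Phase C A) (π π' : C → A) : 0 ≤ estVar Pi κ P π π' :=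
  weightedSq_nonneg (freq_nonneg Pi κ P) (fun c a => (explore_pos Pi κ P c a).le) _

lemma scale_pos (P : Phase C A) (π π' : C → A) : 0 < scale Pi κ P π π' := by
  have := card_pos_real (A := A)
  have := estVar_nonneg Pi κ P π π'
  have := accuracy_pos P.index
  unfold scale
  positivity

lemma scale_le (P : Phase C A) (π π' : C → A) :
    scale Pi κ P π π' ≤ 1 / (2 * Fintype.card A) := by
  have := card_pos_real (A := A)
  have := estVar_nonneg Pi κ P π π'
  have := accuracy_pos P.index
  unfold scale
  refine one_div_le_one_div_of_le (by positivity) ?_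
  have : 0 ≤ 48 * estVar Pi κ P π π' / accuracy P.index := by positivity
  linarith

/-- The tests: an upper and a lower one for the frequency of each context, and one for the
estimated value difference of each ordered pair of policies. -/
abbrev Test (C A : Type*) : Type _ := (C × Bool) ⊕ ((C → A) × (C → A))

/-- The tests to which the union bound is applied. -/
def tests : Finset (Test C A) := Finset.univ.disjSum (Pi ×ˢ Pi)

/-- The contribution of a round to the exponent of a test which does not depend on the reward. -/
def testConst : Test C A → C → A → ℝ
  | .inl (c₀, true), c, _ => if c = c₀ then 1 / 2 else 0
  | .inl (c₀, false), c, _ => if c = c₀ then -(1 / 2) else 0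
  | .inr _, _, _ => 0

/-- The factor of the reward in the contribution of a round to the exponent of a test. -/
def testCoeff (P : Phase C A) : Test C A → C → A → ℝ
  | .inl _, _, _ => 0
  | .inr (π, π'), c, a =>
    scale Pi κ P π π' * (ipsWeight Pi κ P π c a - ipsWeight Pi κ P π' c a)

/-- The bound on the logarithm of the exponential moment of the contribution of a round. -/
def testDrift (P : Phase C A) : Test C A → ℝ
  | .inl (c₀, true) => 3 / 4 * M.ctx.real {c₀}
  | .inl (c₀, false) => -(1 / 4) * M.ctx.real {c₀}
  | .inr (π, π') => scale Pi κ P π π' * reliableDiff Pi κ M P π π'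
      + scale Pi κ P π π' ^ 2 * trueVar Pi κ M P π π'

/-- The exponent of a test: its exponential is a nonnegative supermartingale during a phase. -/
def exponent (z : State C A) : Test C A → ℝ
  | .inl (c₀, true) => z.1.count c₀ / 2 - z.1.elapsed * testDrift Pi κ M z.1.phase (.inl (c₀, true))
  | .inl (c₀, false) =>
    -(z.1.count c₀ / 2) - z.1.elapsed * testDrift Pi κ M z.1.phase (.inl (c₀, false))
  | .inr (π, π') => scale Pi κ z.1.phase π π' * (z.2 π - z.2 π')
      - z.1.elapsed * testDrift Pi κ M z.1.phase (.inr (π, π'))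

lemma exponent_update (z : State C A) (o : Obs C A) (j : Test C A) :
    exponent Pi κ M (update Pi κ z o) j = exponent Pi κ M z j
      + (testConst j o.1 o.2.2.1
        + testCoeff Pi κ z.1.phase j o.1 o.2.2.1 * clip o.2.2.2 - testDrift Pi κ M z.1.phase j) := by
  rcases j with ⟨c₀, _ | _⟩ | ⟨π, π'⟩
  · by_cases h : o.1 = c₀ <;>
      simp [exponent, update, updateControl, testConst, testCoeff, h] <;> ring
  · by_cases h : o.1 = c₀ <;>
      simp [exponent, update, updateControl, testConst, testCoeff, h] <;> ring
  · simp [exponent, update, updateControl, testConst, testCoeff]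
    ring

lemma ipsWeight_sub (P : Phase C A) (π π' : C → A) (c : C) (a : A) :
    ipsWeight Pi κ P π c a - ipsWeight Pi κ P π' c a
      = if c ∈ reliable Pi κ P then diff π π' c a / explore Pi κ P c a else 0 := by
  unfold ipsWeight diff
  split_ifs <;> ring

lemma abs_testCoeff_pair_le (P : Phase C A) (π π' : C → A) (c : C) (a : A) :
    |testCoeff Pi κ P (.inr (π, π')) c a| ≤ 1 := by
  have hA := card_pos_real (A := A)
  have hp := explore_pos Pi κ P c a
  have hw : |ipsWeight Pi κ P π c a - ipsWeight Pi κ P π' c a| ≤ 2 * Fintype.card A := by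
    rw [ipsWeight_sub]
    split_ifs
    · rw [abs_div, abs_of_pos hp, div_le_iff₀ hp]
      have h1 := abs_diff_le π π' c a
      have h2 := le_explore Pi κ P c a
      rw [div_le_iff₀ (by positivity)] at h2
      linarith
    · simp
  rw [testCoeff, abs_mul, abs_of_pos (scale_pos Pi κ P π π')]
  calc _ ≤ 1 / (2 * (Fintype.card A : ℝ)) * (2 * Fintype.card A) :=
        mul_le_mul (scale_le Pi κ P π π') hw (abs_nonneg _) (by positivity)
    _ = 1 := by field_simp

lemma abs_test_le (P : Phase C A) (j : Test C A) (c : C) (a : A) :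
    |testConst j c a| + |testCoeff Pi κ P j c a| ≤ 1 := by
  rcases j with ⟨c₀, _ | _⟩ | ⟨π, π'⟩
  · simp only [testConst, testCoeff]; split_ifs <;> norm_num [abs_div]
  · simp only [testConst, testCoeff]; split_ifs <;> norm_num [abs_div]
  · simpa [testConst] using abs_testCoeff_pair_le Pi κ P π π' c a

lemma sum_test_le_drift (P : Phase C A) (j : Test C A) :
    ∑ c, ∑ a, M.ctx.real {c} * explore Pi κ P c a *
      (testConst j c a + testCoeff Pi κ P j c a * M.meanReward c a
        + (|testConst j c a| + |testCoeff Pi κ P j c a|) ^ 2) ≤ testDrift Pi κ M P j := by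
  have hsum : ∀ (c : C) (k : ℝ), ∑ a, M.ctx.real {c} * explore Pi κ P c a * k
      = M.ctx.real {c} * k := by
    intro c k
    rw [← Finset.sum_mul, ← Finset.mul_sum, stdSimplex.sum_eq_one, mul_one]
  rcases j with ⟨c₀, _ | _⟩ | ⟨π, π'⟩
  · simp only [testConst, testCoeff, testDrift]
    rw [Finset.sum_eq_single c₀]
    · norm_num [abs_div]; rw [hsum]; linarith
    · intro c _ hc; simp [hc]
    · simp
  · simp only [testConst, testCoeff, testDrift]
    rw [Finset.sum_eq_single c₀]
    · norm_num [abs_div]; rw [hsum]; linarith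
    · intro c _ hc; simp [hc]
    · simp
  · simp only [testConst, testCoeff, testDrift, reliableDiff, trueVar, weightedSq, trueFreq,
      Finset.mul_sum, ← Finset.sum_add_distrib, ipsWeight_sub, abs_zero, zero_add, sq_abs]
    refine (Finset.sum_congr rfl fun c _ => Finset.sum_congr rfl fun a _ => ?_).le
    have hp := (explore_pos Pi κ P c a).ne'
    split_ifs
    · field_simp
    · simp

/-- During a phase the exponential of each exponent is a supermartingale. -/
lemma lintegral_exp_exponent_update_le (z : State C A) (j : Test C A) :
    ∫⁻ n, ENNReal.ofReal (Real.exp (exponent Pi κ M (noisyUpdate Pi κ z n) j)) ∂M.roundLaw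
      ≤ ENNReal.ofReal (Real.exp (exponent Pi κ M z j)) := by
  have h := lintegral_exp_roundLaw_le M (explore Pi κ z.1.phase)
    (abs_test_le Pi κ z.1.phase j) (sum_test_le_drift Pi κ M z.1.phase j)
  calc _ = ∫⁻ n, ENNReal.ofReal (Real.exp (exponent Pi κ M z j)) * ENNReal.ofReal (Real.exp
          (testConst j n.1 (sampler (explore Pi κ z.1.phase n.1) n.2.1)
          + testCoeff Pi κ z.1.phase j n.1 (sampler (explore Pi κ z.1.phase n.1) n.2.1)
            * clip (n.2.2 n.1 (sampler (explore Pi κ z.1.phase n.1) n.2.1))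
          - testDrift Pi κ M z.1.phase j)) ∂M.roundLaw := by
        refine lintegral_congr fun n => ?_
        rw [noisyUpdate, exponent_update, Real.exp_add, ENNReal.ofReal_mul (Real.exp_pos _).le]
    _ ≤ _ := by
        rw [lintegral_const_mul' _ _ ENNReal.ofReal_ne_top]
        exact mul_le_of_le_one_right' h

/-- A completed phase in which some test fails. -/
def badStates : Set (State C A) :=
  {z | ¬ z.1.elapsed < len Pi κ z.1.phase ∧
    ∃ j ∈ tests Pi, logTerm Pi κ z.1.phase.index < exponent Pi κ M z j}

/-- The potential: the failure probabilities of the tests of the current phase, weighted with the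
exponentials of their exponents, and the failure probabilities of all later phases. -/
def potential (z : State C A) : ENNReal :=
  ∑ j ∈ tests Pi, ENNReal.ofReal (errProb Pi κ z.1.phase.index) *
      ENNReal.ofReal (Real.exp (exponent Pi κ M z j))
    + ENNReal.ofReal (κ / 2 ^ (z.1.phase.index + 1))

lemma measurable_exponent (j : Test C A) : Measurable fun z : State C A => exponent Pi κ M z j := by
  have hd : ∀ f : Control C A → ℝ, Measurable fun z : State C A => f z.1 := fun f =>
    (Measurable.of_discrete (f := f)).comp measurable_fst
  rcases j with ⟨c₀, _ | _⟩ | ⟨π, π'⟩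
  · exact hd fun z => -(z.count c₀ / 2) - z.elapsed * testDrift Pi κ M z.phase (.inl (c₀, false))
  · exact hd fun z => z.count c₀ / 2 - z.elapsed * testDrift Pi κ M z.phase (.inl (c₀, true))
  · have h1 := hd fun z => scale Pi κ z.phase π π'
    have h2 := hd fun z => z.elapsed * testDrift Pi κ M z.phase (.inr (π, π'))
    have h3 : Measurable fun z : State C A => z.2 π - z.2 π' := by fun_prop
    exact (h1.mul h3).sub h2

lemma measurable_potential : Measurable (potential Pi κ M) := by
  have hd : ∀ f : Control C A → ENNReal, Measurable fun z : State C A => f z.1 := fun f =>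
    (Measurable.of_discrete (f := f)).comp measurable_fst
  refine Measurable.add (Finset.measurable_sum _ fun j _ => ?_)
    (hd fun z => ENNReal.ofReal (κ / 2 ^ (z.phase.index + 1)))
  exact (hd fun z => ENNReal.ofReal (errProb Pi κ z.phase.index)).mul
    (ENNReal.measurable_ofReal.comp (Real.measurable_exp.comp (measurable_exponent Pi κ M j)))

lemma measurableSet_badStates : MeasurableSet (badStates Pi κ M) := by
  have hd : ∀ f : Control C A → ℝ, Measurable fun z : State C A => f z.1 := fun f =>
    (Measurable.of_discrete (f := f)).comp measurable_fst
  have h1 : MeasurableSet {z : State C A | ¬ z.1.elapsed < len Pi κ z.1.phase} :=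
    measurable_fst (MeasurableSet.of_discrete
      (s := {z : Control C A | ¬ z.elapsed < len Pi κ z.phase}))
  have h2 : MeasurableSet (⋃ j ∈ tests Pi,
      {z : State C A | logTerm Pi κ z.1.phase.index < exponent Pi κ M z j}) :=
    Finset.measurableSet_biUnion _ fun j _ =>
      measurableSet_lt (hd fun z => logTerm Pi κ z.phase.index) (measurable_exponent Pi κ M j)
  convert h1.inter h2 using 1
  ext z
  simp [badStates]

lemma card_tests : ((tests Pi).card : ℝ) = numTests Pi := by
  simp only [tests, numTests, Finset.card_disjSum, Finset.card_product, Finset.card_univ,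
    Fintype.card_prod, Fintype.card_bool]
  push_cast
  ring

variable {Pi κ}

lemma numTests_pos (hPi : Pi.Nonempty) : 0 < numTests Pi := by
  have : (0 : ℝ) < Pi.card := by exact_mod_cast hPi.card_pos
  unfold numTests
  positivity

lemma errProb_pos (hPi : Pi.Nonempty) (hκ : 0 < κ) (l : ℕ) : 0 < errProb Pi κ l := by
  have := numTests_pos hPi
  unfold errProb
  positivity

lemma exp_logTerm (hPi : Pi.Nonempty) (hκ : 0 < κ) (l : ℕ) :
    errProb Pi κ l * Real.exp (logTerm Pi κ l) = 1 := by
  have := numTests_pos hPi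
  rw [logTerm, Real.exp_log (by positivity), errProb]
  field_simp

/-- At the beginning of a phase all exponents vanish, so that the potential is the sum of the failure
probabilities of this phase and the later ones. -/
lemma potential_start (hPi : Pi.Nonempty) (hκ : 0 < κ) (P : Phase C A) :
    potential Pi κ M (⟨P, 0, 0⟩, 0) = ENNReal.ofReal (κ / 2 ^ P.index) := by
  have h0 : ∀ j, exponent Pi κ M (⟨P, 0, 0⟩, 0) j = 0 := by
    rintro (⟨c₀, _ | _⟩ | ⟨π, π'⟩) <;> simp [exponent]
  have hn := numTests_pos hPi
  simp only [potential, h0, Real.exp_zero, ENNReal.ofReal_one, mul_one, Finset.sum_const,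
    nsmul_eq_mul]
  rw [← ENNReal.ofReal_natCast, ← ENNReal.ofReal_mul (by positivity),
    ← ENNReal.ofReal_add (mul_nonneg (by positivity) (errProb_pos hPi hκ _).le) (by positivity),
    card_tests, errProb]
  congr 1
  field_simp
  ring

/-- With probability at least `1 - κ` no test fails at the end of any phase. -/
theorem measure_exists_badStates_le (hPi : Pi.Nonempty) (hκ : 0 < κ) :
    M.law {ω | ∃ t, noisyUpdate Pi κ (path Pi κ ω t) (ω t) ∈ badStates Pi κ M}
      ≤ ENNReal.ofReal κ := by
  have : IsProbabilityMeasure M.roundLaw := by unfold Instance.roundLaw; infer_instance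
  have h := measure_exists_bad_le (initState Pi) M.roundLaw (measurable_noisyUpdate Pi κ)
    (measurable_settle Pi κ) (measurableSet_badStates Pi κ M) (measurable_potential Pi κ M)
    ?_ ?_ ?_
  · refine h.trans_eq ?_
    rw [initState, potential_start M hPi hκ]
    simp
  · intro z
    have hm : ∀ j, Measurable fun n => exponent Pi κ M (noisyUpdate Pi κ z n) j := fun j =>
      (measurable_exponent Pi κ M j).comp ((measurable_noisyUpdate Pi κ).comp
        (measurable_const (a := z).prodMk measurable_id))
    have hme : ∀ j, Measurable fun n =>
        ENNReal.ofReal (Real.exp (exponent Pi κ M (noisyUpdate Pi κ z n) j)) := fun j =>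
      ENNReal.measurable_ofReal.comp (Real.measurable_exp.comp (hm j))
    have hphase : ∀ n, (noisyUpdate Pi κ z n).1.phase = z.1.phase := fun n => rfl
    simp only [potential, hphase]
    rw [lintegral_add_right _ measurable_const, lintegral_finsetSum _ fun j _ => (hme j).const_mul _]
    simp only [lintegral_const, measure_univ, mul_one]
    gcongr with j _
    rw [lintegral_const_mul' _ _ ENNReal.ofReal_ne_top]
    gcongr
    exact lintegral_exp_exponent_update_le Pi κ M z j
  · rintro z ⟨-, j, hj, hlt⟩
    refine le_add_right ((?_ : (1 : ENNReal) ≤ _).trans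
      (Finset.single_le_sum (fun _ _ => zero_le) hj))
    rw [← ENNReal.ofReal_mul (errProb_pos hPi hκ _).le, ← ENNReal.ofReal_one,
      ← exp_logTerm hPi hκ z.1.phase.index]
    refine ENNReal.ofReal_le_ofReal ?_
    have := errProb_pos hPi hκ z.1.phase.index
    gcongr
  · intro z _
    unfold settle
    split_ifs
    · exact le_rfl
    · rw [nextControl, potential_start M hPi hκ]
      exact le_add_self

end Potential

/-! ### Correctness of the phases -/

@[simp] lemma accuracy_zero : accuracy 0 = 1 := by simp [accuracy]

@[simp] lemma accuracy_one : accuracy 1 = 1 := by simp [accuracy]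

lemma accuracy_le_one (l : ℕ) : accuracy l ≤ 1 := pow_le_one₀ (by norm_num) (by norm_num)

lemma accuracy_succ {l : ℕ} (hl : 0 < l) : accuracy (l + 1) = accuracy l / 2 := by
  obtain ⟨k, rfl⟩ := Nat.exists_eq_add_of_le' hl
  simp only [accuracy, Nat.add_sub_cancel]
  rw [pow_succ]
  ring

lemma half_accuracy_le (l : ℕ) : accuracy l / 2 ≤ accuracy (l + 1) := by
  rcases Nat.eq_zero_or_pos l with rfl | hl
  · norm_num
  · exact (accuracy_succ hl).ge

section Values

variable (M : Instance C A)

lemma sum_diff_mul (π π' : C → A) (c : C) (f : A → ℝ) :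
    ∑ a, diff π π' c a * f a = f (π c) - f (π' c) := by
  simp [diff, ofDet, sub_mul, Finset.sum_sub_distrib]

lemma value_sub_value (π π' : C → A) :
    M.value π - M.value π' = ∑ c, ∑ a, M.ctx.real {c} * diff π π' c a * M.meanReward c a := by
  simp only [Instance.value, Instance.phi, ← Finset.sum_sub_distrib, diff]
  exact Finset.sum_congr rfl fun c _ => Finset.sum_congr rfl fun a _ => by ring

lemma abs_sum_diff_mul_le (π π' : C → A) (c : C) :
    |∑ a, diff π π' c a * M.meanReward c a| ≤ 1 := by
  rw [sum_diff_mul, abs_le]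
  have h1 := meanReward_mem M c (π c)
  have h2 := meanReward_mem M c (π' c)
  constructor <;> linarith

lemma value_sub_le_one (π π' : C → A) : M.value π - M.value π' ≤ 1 := by
  rw [value_sub_value, ← sum_ctx_real M]
  refine Finset.sum_le_sum fun c _ => ?_
  simp_rw [mul_assoc, ← Finset.mul_sum]
  exact mul_le_of_le_one_right measureReal_nonneg (abs_le.1 (abs_sum_diff_mul_le M π π' c)).2

end Values

section Logarithms

variable {Pi : Finset (C → A)} {κ : ℝ} (hPi : Pi.Nontrivial) (hκ : 0 < κ) (hκ1 : κ < 1)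

include hPi in
lemma four_le_numTests : 4 ≤ numTests Pi := by
  have h : (2 : ℝ) ≤ Pi.card := by exact_mod_cast Finset.one_lt_card_iff_nontrivial.2 hPi
  have : (0 : ℝ) ≤ Fintype.card C := by positivity
  unfold numTests
  nlinarith

include hPi hκ hκ1 in
lemma one_le_logTerm (l : ℕ) : 1 ≤ logTerm Pi κ l := by
  have h := four_le_numTests hPi
  have h2 : (1 : ℝ) ≤ 2 ^ (l + 1) := one_le_pow₀ (by norm_num)
  rw [logTerm, Real.le_log_iff_exp_le (by positivity)]
  have h3 : (4 : ℝ) ≤ 2 ^ (l + 1) * numTests Pi := by nlinarith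
  rw [le_div_iff₀ hκ]
  have := Real.exp_one_lt_d9
  nlinarith

include hPi hκ in
lemma logTerm_le_succ (l : ℕ) : logTerm Pi κ l ≤ logTerm Pi κ (l + 1) := by
  have h := four_le_numTests hPi
  unfold logTerm
  refine Real.log_le_log (by positivity) ?_
  gcongr
  · norm_num
  · omega

end Logarithms

variable {Pi : Finset (C → A)} {κ : ℝ} (M : Instance C A)

variable (Pi κ) in
/-- The context counts of the preceding phase have passed their tests, and that phase was long enough
for the unreliable contexts to be negligible. Phase `0` has no context counts. -/
def Calibrated (P : Phase C A) : Prop :=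
  (P.index = 0 ∧ ∀ c, P.prevCount c = 0) ∨
    (0 < P.index ∧
      (∀ c, (P.prevCount c : ℝ) / 2 - P.prevLen * (3 / 4 * M.ctx.real {c}) ≤ logTerm Pi κ P.index) ∧
      (∀ c, -((P.prevCount c : ℝ) / 2) - P.prevLen * (-(1 / 4) * M.ctx.real {c})
        ≤ logTerm Pi κ P.index) ∧
      96 * Fintype.card C * logTerm Pi κ P.index ≤ P.prevLen * accuracy P.index)

section Calibration

variable (hPi : Pi.Nontrivial) (hκ : 0 < κ) (hκ1 : κ < 1) {P : Phase C A}

include hPi in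
lemma card_ctx_pos : 0 < (Fintype.card C : ℝ) := by
  obtain ⟨π, -, π', -, h⟩ := hPi
  obtain ⟨c, -⟩ := Function.ne_iff.1 h
  exact_mod_cast Fintype.card_pos_iff.2 ⟨c⟩

include hPi hκ hκ1

lemma prevLen_pos
    (h : 96 * Fintype.card C * logTerm Pi κ P.index ≤ P.prevLen * accuracy P.index) :
    0 < (P.prevLen : ℝ) := by
  have h1 := one_le_logTerm hPi hκ hκ1 P.index
  have h2 := card_ctx_pos hPi
  have h3 : 0 < 96 * Fintype.card C * logTerm Pi κ P.index := by positivity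
  exact pos_of_mul_pos_left (h3.trans_le h) (accuracy_pos _).le

lemma Calibrated.freq_le (h : Calibrated Pi κ M P) (c : C) :
    freq Pi κ P c ≤ 3 * trueFreq Pi κ M P c := by
  have h1 := one_le_logTerm hPi hκ hκ1 P.index
  unfold freq trueFreq
  split_ifs with hc
  · simp only [reliable, Finset.mem_filter, Finset.mem_univ, true_and] at hc
    rcases h with ⟨-, h⟩ | ⟨hi, hup, -, hlen⟩
    · simp only [h, Nat.cast_zero] at hc; linarith
    · rw [div_le_iff₀ (prevLen_pos hPi hκ hκ1 hlen)]
      linarith [hup c]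
  · simp

lemma Calibrated.trueFreq_le (h : Calibrated Pi κ M P) (c : C) :
    trueFreq Pi κ M P c ≤ 3 * freq Pi κ P c := by
  have h1 := one_le_logTerm hPi hκ hκ1 P.index
  unfold freq trueFreq
  split_ifs with hc
  · simp only [reliable, Finset.mem_filter, Finset.mem_univ, true_and] at hc
    rcases h with ⟨-, h⟩ | ⟨hi, -, hlow, hlen⟩
    · simp only [h, Nat.cast_zero] at hc; linarith
    · rw [← mul_div_assoc, le_div_iff₀ (prevLen_pos hPi hκ hκ1 hlen)]
      linarith [hlow c]
  · simp

lemma Calibrated.trueFreq_eq_zero (h : Calibrated Pi κ M P) (hi : P.index = 0) (c : C) :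
    trueFreq Pi κ M P c = 0 := by
  have h1 := one_le_logTerm hPi hκ hκ1 P.index
  rcases h with ⟨-, h⟩ | ⟨hi', -⟩
  · refine if_neg fun hc => ?_
    simp only [reliable, Finset.mem_filter, Finset.mem_univ, true_and, h, Nat.cast_zero] at hc
    linarith
  · omega

lemma Calibrated.unreliable_le (h : Calibrated Pi κ M P) (hi : 0 < P.index) :
    ∑ c, (M.ctx.real {c} - trueFreq Pi κ M P c) ≤ accuracy P.index / 8 := by
  have h1 := one_le_logTerm hPi hκ hκ1 P.index
  rcases h with ⟨hi', -⟩ | ⟨-, -, hlow, hlen⟩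
  · omega
  have hm := prevLen_pos hPi hκ hκ1 hlen
  have hc : ∀ c, M.ctx.real {c} - trueFreq Pi κ M P c
      ≤ 12 * logTerm Pi κ P.index / P.prevLen := by
    intro c
    unfold trueFreq
    split_ifs with hc
    · rw [sub_self]; positivity
    · simp only [reliable, Finset.mem_filter, Finset.mem_univ, true_and, not_le] at hc
      rw [sub_zero, le_div_iff₀ hm]
      linarith [hlow c]
  calc _ ≤ ∑ _c : C, 12 * logTerm Pi κ P.index / P.prevLen := Finset.sum_le_sum fun c _ => hc c
    _ = 12 * Fintype.card C * logTerm Pi κ P.index / P.prevLen := by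
      rw [Finset.sum_const, Finset.card_univ, nsmul_eq_mul]; ring
    _ ≤ accuracy P.index / 8 := by
      rw [div_le_iff₀ hm]; linarith

/-- Ignoring the unreliable contexts costs an eighth of the accuracy. -/
lemma Calibrated.abs_reliableDiff_sub_le (h : Calibrated Pi κ M P) (hi : 0 < P.index)
    (π π' : C → A) :
    |reliableDiff Pi κ M P π π' - (M.value π - M.value π')| ≤ accuracy P.index / 8 := by
  refine le_trans ?_ (h.unreliable_le M hPi hκ hκ1 hi)
  rw [value_sub_value, abs_sub_comm, reliableDiff, ← Finset.sum_sub_distrib]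
  refine (Finset.abs_sum_le_sum_abs _ _).trans (Finset.sum_le_sum fun c _ => ?_)
  have h0 : 0 ≤ M.ctx.real {c} - trueFreq Pi κ M P c := by
    unfold trueFreq; split_ifs <;> simp
  have : ∑ a, M.ctx.real {c} * diff π π' c a * M.meanReward c a
      - ∑ a, trueFreq Pi κ M P c * diff π π' c a * M.meanReward c a
      = (M.ctx.real {c} - trueFreq Pi κ M P c) * ∑ a, diff π π' c a * M.meanReward c a := by
    rw [← Finset.sum_sub_distrib, Finset.mul_sum]
    exact Finset.sum_congr rfl fun a _ => by ring
  rw [this, abs_mul, abs_of_nonneg h0]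
  exact mul_le_of_le_one_right h0 (abs_sum_diff_mul_le M π π' c)

lemma Calibrated.trueVar_le [Nonempty A] (h : Calibrated Pi κ M P) (π π' : C → A) :
    trueVar Pi κ M P π π' ≤ 3 * estVar Pi κ P π π' := by
  unfold trueVar estVar weightedSq
  rw [Finset.mul_sum]
  refine Finset.sum_le_sum fun c _ => ?_
  rw [Finset.mul_sum]
  refine Finset.sum_le_sum fun a _ => ?_
  rw [← mul_div_assoc, ← mul_assoc]
  have h1 := (explore_pos Pi κ P c a).le
  have h2 := h.trueFreq_le M hPi hκ hκ1 c
  gcongr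

end Calibration

section Elimination

variable [Nonempty A] (hPi : Pi.Nontrivial) (hκ : 0 < κ) (hκ1 : κ < 1)

include hPi hκ hκ1

/-- If the test of a pair of active policies succeeds at the end of a phase, then their value
difference, restricted to the reliable contexts, is overestimated by at most an eighth of the
accuracy. -/
lemma estimate_le {z : State C A} (hcal : Calibrated Pi κ M z.1.phase)
    (hlen : z.1.elapsed = len Pi κ z.1.phase) {π π' : C → A} (hπ : π ∈ z.1.phase.active)
    (hπ' : π' ∈ z.1.phase.active)
    (htest : exponent Pi κ M z (.inr (π, π')) ≤ logTerm Pi κ z.1.phase.index) :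
    z.2 π - z.2 π' ≤ z.1.elapsed *
      (reliableDiff Pi κ M z.1.phase π π' + accuracy z.1.phase.index / 8) := by
  set P := z.1.phase
  set n : ℝ := (z.1.elapsed : ℝ)
  set D := reliableDiff Pi κ M P π π'
  set e := accuracy P.index with he_def
  set s := scale Pi κ P π π' with hs_def
  set v := trueVar Pi κ M P π π'
  set v' := estVar Pi κ P π π' with hv'_def
  set L := logTerm Pi κ P.index
  have he : 0 < e := accuracy_pos _
  have hs : 0 < s := scale_pos Pi κ P π π'
  have hv' : 0 ≤ v' := estVar_nonneg Pi κ P π π'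
  have hv : v ≤ 3 * v' := hcal.trueVar_le M hPi hκ hκ1 π π'
  have hA : 0 < (Fintype.card A : ℝ) := card_pos_real
  have hL : 1 ≤ L := one_le_logTerm hPi hκ hκ1 _
  have hLL : L ≤ logTerm Pi κ (P.index + 1) := logTerm_le_succ hPi hκ _
  have hn : 0 ≤ n := by positivity
  have hfeas := (feasible_explore Pi κ P).2 π hπ π' hπ'
  rw [← hlen] at hfeas
  change 1536 * logTerm Pi κ (P.index + 1) * v' + _ * e ≤ n * e ^ 2 at hfeas
  have hden : 0 < 2 * Fintype.card A + 48 * v' / e := by positivity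
  have hs_eq : s * (2 * Fintype.card A + 48 * v' / e) = 1 := by
    rw [hs_def, scale, ← he_def, ← hv'_def]
    exact one_div_mul_cancel hden.ne'
  -- the variance term of the exponent
  have h1 : s * v ≤ e / 16 := by
    have h48 : 48 * v' ≤ e * (2 * Fintype.card A + 48 * v' / e) := by
      rw [mul_add, mul_div_cancel₀ _ he.ne']
      have : 0 ≤ e * (2 * Fintype.card A) := by positivity
      linarith
    have h3 : s * (48 * v') ≤ e := by
      calc s * (48 * v') ≤ s * (e * (2 * Fintype.card A + 48 * v' / e)) := by gcongr
        _ = e * (s * (2 * Fintype.card A + 48 * v' / e)) := by ring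
        _ = e := by rw [hs_eq, mul_one]
    nlinarith
  -- the threshold of the test, divided by the scale
  have h2 : L * (2 * Fintype.card A + 48 * v' / e) ≤ n * e / 16 := by
    have h3 : L * (2 * Fintype.card A + 48 * v' / e) * e = L * (2 * Fintype.card A * e + 48 * v') := by
      field_simp
    have h4 : L * (2 * Fintype.card A * e + 48 * v')
        ≤ logTerm Pi κ (P.index + 1) * (2 * Fintype.card A * e + 48 * v') := by gcongr
    have h5 : 0 ≤ 192 * (Fintype.card C : ℝ) * logTerm Pi κ (P.index + 1) * e := by
      have : 0 ≤ logTerm Pi κ (P.index + 1) := by linarith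
      positivity
    have h6 : 0 ≤ logTerm Pi κ (P.index + 1) * v' := mul_nonneg (by linarith) hv'
    have h7 : L * (2 * Fintype.card A + 48 * v' / e) * e ≤ n * e / 16 * e := by
      rw [h3]
      nlinarith
    exact le_of_mul_le_mul_right h7 he
  change s * (z.2 π - z.2 π') - n * (s * D + s ^ 2 * v) ≤ L at htest
  have h8 : s * (z.2 π - z.2 π') ≤ s * (n * (D + e / 8)) := by
    have h9 : L ≤ s * (n * e / 16) := by
      calc L = s * (L * (2 * Fintype.card A + 48 * v' / e)) := by
            rw [mul_left_comm, hs_eq, mul_one]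
        _ ≤ _ := by gcongr
    have h10 : n * (s ^ 2 * v) ≤ n * (s * (e / 16)) := by
      rw [pow_two, mul_assoc]
      gcongr
    nlinarith
  exact le_of_mul_le_mul_left h8 hs

/-- The properties of a phase which hold as long as no test fails: the optimal policy has not been
eliminated, and the gaps of the active policies are within the accuracy. -/
structure Sound (Pi : Finset (C → A)) (κ : ℝ) (M : Instance C A) (πs : C → A) (P : Phase C A) :
    Prop where
  subset : P.active ⊆ Pi
  mem : πs ∈ P.active
  gap_le : ∀ π ∈ P.active, M.value πs - M.value π ≤ accuracy P.index
  calibrated : Calibrated Pi κ M P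

omit hPi hκ hκ1 in
/-- Feasibility for the pair `(π, π)`, which has variance zero. -/
lemma len_mul_accuracy_ge {P : Phase C A} {π : C → A} (hπ : π ∈ P.active) :
    (64 * Fintype.card A + 192 * Fintype.card C) * logTerm Pi κ (P.index + 1)
      ≤ len Pi κ P * accuracy P.index := by
  have h := (feasible_explore Pi κ P).2 π hπ π hπ
  have he := accuracy_pos P.index
  have h0 : weightedSq (freq Pi κ P) (fun c => explore Pi κ P c) (diff π π) = 0 := by
    simp [weightedSq, diff]
  rw [h0, mul_zero, zero_add, pow_two, ← mul_assoc] at h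
  exact le_of_mul_le_mul_right h he

/-- A sound phase in which no test fails leads to a sound phase. After phase `0`, in which nothing is
estimated, this holds because no gap exceeds `accuracy 1 = 1`. -/
lemma Sound.next {πs : C → A} (hopt : M.IsOptimal Pi πs) {z : State C A}
    (h : Sound Pi κ M πs z.1.phase) (hlen : z.1.elapsed = len Pi κ z.1.phase)
    (hgood : z ∉ badStates Pi κ M) : Sound Pi κ M πs (nextControl z.1 (Beats z)).phase := by
  classical
  have htest : ∀ j ∈ tests Pi, exponent Pi κ M z j ≤ logTerm Pi κ z.1.phase.index := by
    intro j hj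
    by_contra hlt
    exact hgood ⟨by simp [hlen], j, hj, not_le.1 hlt⟩
  have hpair : ∀ π ∈ z.1.phase.active, ∀ π' ∈ z.1.phase.active,
      z.2 π - z.2 π' ≤ z.1.elapsed *
        (reliableDiff Pi κ M z.1.phase π π' + accuracy z.1.phase.index / 8) :=
    fun π hπ π' hπ' => estimate_le M hPi hκ hκ1 h.calibrated hlen hπ hπ'
      (htest _ (by simp [tests, h.subset hπ, h.subset hπ']))
  have he := accuracy_pos z.1.phase.index
  have hL := one_le_logTerm hPi hκ hκ1 (z.1.phase.index + 1)
  have hS := card_ctx_pos hPi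
  have hA : 0 < (Fintype.card A : ℝ) := card_pos_real
  have hlen' := len_mul_accuracy_ge (Pi := Pi) (κ := κ) h.mem
  rw [← hlen] at hlen'
  have hn : 0 < (z.1.elapsed : ℝ) :=
    pos_of_mul_pos_left ((by positivity : (0 : ℝ) < _).trans_le hlen') he.le
  refine ⟨(Finset.filter_subset _ _).trans h.subset, ?_, ?_, ?_⟩
  · refine Finset.mem_filter.2 ⟨h.mem, fun π hπ hbeats => ?_⟩
    have hD : reliableDiff Pi κ M z.1.phase π πs ≤ accuracy z.1.phase.index / 8 := by
      rcases Nat.eq_zero_or_pos z.1.phase.index with hi | hi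
      · simp only [reliableDiff, h.calibrated.trueFreq_eq_zero M hPi hκ hκ1 hi, zero_mul,
          Finset.sum_const_zero]
        positivity
      · have h1 := (abs_le.1 (h.calibrated.abs_reliableDiff_sub_le M hPi hκ hκ1 hi π πs)).2
        have h2 := hopt.2 π (h.subset hπ)
        linarith
    have h1 := hpair π hπ πs h.mem
    have h2 : (z.1.elapsed : ℝ) *
        (reliableDiff Pi κ M z.1.phase π πs + accuracy z.1.phase.index / 8)
        ≤ z.1.elapsed * (accuracy z.1.phase.index / 4) := by
      gcongr
      linarith
    exact absurd hbeats (not_lt.2 (h1.trans h2))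
  · intro π hπ
    obtain ⟨hπ, hbeats⟩ := Finset.mem_filter.1 hπ
    change _ ≤ accuracy (z.1.phase.index + 1)
    rcases Nat.eq_zero_or_pos z.1.phase.index with hi | hi
    · rw [hi, zero_add, accuracy_one]
      exact value_sub_le_one M πs π
    · have h1 := not_lt.1 (hbeats πs h.mem)
      have h2 := hpair π hπ πs h.mem
      have h3 := (abs_le.1 (h.calibrated.abs_reliableDiff_sub_le M hPi hκ hκ1 hi π πs)).2
      have h4 : (z.1.elapsed : ℝ) * -(accuracy z.1.phase.index / 4) ≤ z.1.elapsed *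
          (reliableDiff Pi κ M z.1.phase π πs + accuracy z.1.phase.index / 8) := by
        linarith
      have h5 := le_of_mul_le_mul_left h4 hn
      rw [accuracy_succ hi]
      linarith
  · refine Or.inr ⟨Nat.succ_pos _, fun c => ?_, fun c => ?_, ?_⟩
    · exact (htest (.inl (c, true)) (by simp [tests])).trans (logTerm_le_succ hPi hκ _)
    · exact (htest (.inl (c, false)) (by simp [tests])).trans (logTerm_le_succ hPi hκ _)
    · change 96 * _ * logTerm Pi κ (z.1.phase.index + 1)
        ≤ z.1.elapsed * accuracy (z.1.phase.index + 1)
      have h1 := mul_le_mul_of_nonneg_left (half_accuracy_le z.1.phase.index) hn.le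
      have h2 : 0 ≤ (Fintype.card A : ℝ) * logTerm Pi κ (z.1.phase.index + 1) := by positivity
      linarith

end Elimination

/-! ### Gaps and complexity -/

section Gaps

variable {Pi : Finset (C → A)} (M : Instance C A) {πs : C → A}

lemma gapMin_le {π : C → A} (hπ : π ∈ Pi) (hne : π ≠ πs) :
    M.gapMin Pi πs ≤ M.value πs - M.value π :=
  ciInf_le (f := fun π : {π // π ∈ Pi.erase πs} => M.value πs - M.value π)
    (Set.finite_range _).bddBelow ⟨π, Finset.mem_erase.2 ⟨hne, hπ⟩⟩

lemma gapMin_nonneg (hopt : M.IsOptimal Pi πs) : 0 ≤ M.gapMin Pi πs :=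
  Real.iInf_nonneg fun π => sub_nonneg.2 (hopt.2 π (Finset.mem_of_mem_erase π.2))

end Gaps

section Norms

variable [Nonempty A] (M : Instance C A)

lemma ofReal_sq_div_ofReal {m q x : ℝ} (hm : 0 ≤ m) (hq : 0 < q) :
    ENNReal.ofReal ((m * x) ^ 2) / ENNReal.ofReal (m * q) = ENNReal.ofReal (m * x ^ 2 / q) := by
  rcases hm.eq_or_lt with rfl | hm
  · simp
  · rw [← ENNReal.ofReal_div_of_pos (by positivity)]
    congr 1
    field_simp

/-- Mixing the exploration policy with another one at least halves no probability and makes all of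
them positive: the terms of the norm at most double. -/
lemma ofReal_sq_div_le {m p q x : ℝ} (hm : 0 ≤ m) (hp : 0 ≤ p) (hq : 0 < q) (hpq : p ≤ 2 * q) :
    ENNReal.ofReal (m * x ^ 2 / q)
      ≤ 2 * (ENNReal.ofReal ((m * x) ^ 2) / ENNReal.ofReal (m * p)) := by
  rcases hp.eq_or_lt with rfl | hp
  · rcases eq_or_ne (m * x) 0 with h | h
    · have : m * x ^ 2 = 0 := by rw [pow_two, ← mul_assoc, h, zero_mul]
      simp [this]
    · have h2 : ENNReal.ofReal ((m * x) ^ 2) ≠ 0 :=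
        (ENNReal.ofReal_pos.2 (by positivity)).ne'
      simp [ENNReal.div_zero h2]
  · rw [ofReal_sq_div_ofReal hm hp, ← ENNReal.ofReal_ofNat, ← ENNReal.ofReal_mul (by norm_num)]
    refine ENNReal.ofReal_le_ofReal ?_
    rw [← mul_div_assoc, div_le_div_iff₀ hq hp]
    have : 0 ≤ m * x ^ 2 := by positivity
    nlinarith

lemma phi_sub_phi (π π' : C → A) (c : C) (a : A) :
    M.phi (ofDet π) c a - M.phi (ofDet π') c a = M.ctx.real {c} * diff π π' c a := by
  simp only [Instance.phi, diff]
  ring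

lemma ofReal_weightedSq {w : C → ℝ} (hw : ∀ c, 0 ≤ w c) {p : C → A → ℝ} (hp : ∀ c a, 0 ≤ p c a)
    (x : C → A → ℝ) :
    ENNReal.ofReal (weightedSq w p x) = ∑ c, ∑ a, ENNReal.ofReal (w c * x c a ^ 2 / p c a) := by
  have h : ∀ c a, 0 ≤ w c * x c a ^ 2 / p c a := fun c a =>
    div_nonneg (mul_nonneg (hw c) (sq_nonneg _)) (hp c a)
  rw [weightedSq, ENNReal.ofReal_sum_of_nonneg fun c _ => Finset.sum_nonneg fun a _ => h c a]
  exact Finset.sum_congr rfl fun c _ => ENNReal.ofReal_sum_of_nonneg fun a _ => h c a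

lemma ofReal_weightedSq_le_sqNorm {p q : C → A → ℝ} (hp : ∀ c a, 0 ≤ p c a)
    (hq : ∀ c a, 0 < q c a) (hpq : ∀ c a, p c a ≤ 2 * q c a) (π π' : C → A) :
    ENNReal.ofReal (weightedSq (fun c => M.ctx.real {c}) q (diff π π'))
      ≤ 2 * M.sqNorm p fun c a => M.phi (ofDet π) c a - M.phi (ofDet π') c a := by
  rw [ofReal_weightedSq (fun c => measureReal_nonneg) fun c a => (hq c a).le, Instance.sqNorm,
    Finset.mul_sum]
  refine Finset.sum_le_sum fun c _ => ?_
  rw [Finset.mul_sum]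
  refine Finset.sum_le_sum fun a _ => ?_
  rw [phi_sub_phi, Instance.phi]
  exact ofReal_sq_div_le measureReal_nonneg (hp c a) (hq c a) (hpq c a)

lemma sum_diff_sq_le (π π' : C → A) (c : C) : ∑ a, diff π π' c a ^ 2 ≤ 2 := by
  have h : ∀ a, diff π π' c a ^ 2 ≤ ofDet π c a + ofDet π' c a := by
    intro a
    unfold diff ofDet
    split_ifs <;> norm_num
  refine (Finset.sum_le_sum fun a _ => h a).trans ?_
  simp only [Finset.sum_add_distrib, ofDet, Finset.sum_ite_eq, Finset.mem_univ, if_true]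
  norm_num

lemma weightedSq_barycenter_le {w : C → ℝ} (hw : ∀ c, 0 ≤ w c) (π π' : C → A) :
    weightedSq w (fun _ => (stdSimplex.barycenter : stdSimplex ℝ A)) (diff π π')
      ≤ (∑ c, w c) * (2 * Fintype.card A) := by
  rw [weightedSq, Finset.sum_mul]
  refine Finset.sum_le_sum fun c _ => ?_
  have h : ∀ a, w c * diff π π' c a ^ 2 / (stdSimplex.barycenter : stdSimplex ℝ A) a
      = w c * Fintype.card A * diff π π' c a ^ 2 := by
    intro a
    change _ / (Fintype.card A : ℝ)⁻¹ = _
    rw [div_inv_eq_mul]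
    ring
  simp_rw [h, ← Finset.mul_sum]
  have h1 : 0 ≤ w c * Fintype.card A := mul_nonneg (hw c) (by positivity)
  nlinarith [sum_diff_sq_le π π' c]

lemma weightedSq_triangle {w : C → ℝ} (hw : ∀ c, 0 ≤ w c) {p : C → A → ℝ}
    (hp : ∀ c a, 0 ≤ p c a) (πs π π' : C → A) :
    weightedSq w p (diff π π')
      ≤ 2 * weightedSq w p (diff πs π) + 2 * weightedSq w p (diff πs π') := by
  simp only [weightedSq, Finset.mul_sum, ← Finset.sum_add_distrib]
  refine Finset.sum_le_sum fun c _ => Finset.sum_le_sum fun a _ => ?_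
  simp only [← mul_div_assoc, ← add_div]
  refine div_le_div_of_nonneg_right ?_ (hp c a)
  have h : diff π π' c a ^ 2 ≤ 2 * diff πs π c a ^ 2 + 2 * diff πs π' c a ^ 2 := by
    unfold diff
    nlinarith [sq_nonneg (ofDet πs c a - ofDet π c a + (ofDet πs c a - ofDet π' c a))]
  have := mul_le_mul_of_nonneg_left h (hw c)
  linarith

/-- Uniform exploration bounds the complexity. -/
lemma rho_le {Pi : Finset (C → A)} {πs : C → A} {ε : ℝ} (hD : 0 < max (M.gapMin Pi πs) ε)
    (hgap : 0 ≤ M.gapMin Pi πs) :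
    M.rho Pi πs ε ≤ ENNReal.ofReal (2 * Fintype.card A / max (M.gapMin Pi πs) ε ^ 2) := by
  refine (iInf_le _ fun _ => stdSimplex.barycenter).trans (iSup₂_le fun π _ => ?_)
  rw [ENNReal.ofReal_div_of_pos (by positivity)]
  refine ENNReal.div_le_div ?_ (ENNReal.ofReal_le_ofReal ?_)
  · calc _ = ENNReal.ofReal (weightedSq (fun c => M.ctx.real {c})
          (fun _ => (stdSimplex.barycenter : stdSimplex ℝ A)) (diff πs π)) := by
          rw [ofReal_weightedSq (fun c => measureReal_nonneg) fun c a =>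
            stdSimplex.zero_le _ a, Instance.sqNorm]
          refine Finset.sum_congr rfl fun c _ => Finset.sum_congr rfl fun a _ => ?_
          rw [phi_sub_phi, Instance.phi]
          exact ofReal_sq_div_ofReal measureReal_nonneg (inv_pos.2 card_pos_real)
      _ ≤ _ := by
          refine ENNReal.ofReal_le_ofReal ((weightedSq_barycenter_le
            (fun c => measureReal_nonneg) πs π).trans_eq ?_)
          rw [sum_ctx_real, one_mul]
  · rcases max_cases (M.gapMin Pi πs) ε with ⟨h, -⟩ | ⟨h, -⟩
    · rw [h]
      refine le_max_of_le_right (pow_le_pow_left₀ hgap (le_max_right _ _) 2)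
    · rw [h]
      exact le_max_left _ _

end Norms

section Length

variable [Nonempty A] (M : Instance C A) {Pi : Finset (C → A)} {κ : ℝ} {πs : C → A}

/-- The policy which explores with `p` or uniformly, with probability one half each. -/
def mixUniform (p : C → stdSimplex ℝ A) (c : C) : stdSimplex ℝ A :=
  ⟨fun a => (p c a + (Fintype.card A : ℝ)⁻¹) / 2, fun a => by
    have := stdSimplex.zero_le (p c) a
    positivity, by
    rw [← Finset.sum_div, Finset.sum_add_distrib, stdSimplex.sum_eq_one]
    simp⟩

lemma mixUniform_apply (p : C → stdSimplex ℝ A) (c : C) (a : A) :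
    mixUniform p c a = (p c a + (Fintype.card A : ℝ)⁻¹) / 2 := rfl

lemma le_mixUniform (p : C → stdSimplex ℝ A) (c : C) (a : A) :
    1 / (2 * (Fintype.card A : ℝ)) ≤ mixUniform p c a := by
  rw [mixUniform_apply]
  have h1 := stdSimplex.zero_le (p c) a
  have h2 : 1 / (2 * (Fintype.card A : ℝ)) = (Fintype.card A : ℝ)⁻¹ / 2 := by ring
  rw [h2]
  linarith

lemma mixUniform_pos (p : C → stdSimplex ℝ A) (c : C) (a : A) : 0 < mixUniform p c a := by
  have h1 := stdSimplex.zero_le (p c) a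
  have h2 := card_pos_real (A := A)
  rw [mixUniform_apply]
  positivity

lemma le_two_mul_mixUniform (p : C → stdSimplex ℝ A) (c : C) (a : A) :
    p c a ≤ 2 * mixUniform p c a := by
  have h2 := card_pos_real (A := A)
  have : 0 < (Fintype.card A : ℝ)⁻¹ := by positivity
  rw [mixUniform_apply]
  linarith

variable (hPi : Pi.Nontrivial) (hκ : 0 < κ) (hκ1 : κ < 1)

include hPi hκ hκ1

lemma len_le_of_weightedSq_le {P : Phase C A} {p : C → stdSimplex ℝ A}
    (hp : ∀ c a, 1 / (2 * (Fintype.card A : ℝ)) ≤ p c a) {B : ℝ} (hB0 : 0 ≤ B)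
    (hB : ∀ π ∈ P.active, ∀ π' ∈ P.active,
      weightedSq (freq Pi κ P) (fun c => p c) (diff π π') ≤ accuracy P.index ^ 2 * B) :
    (len Pi κ P : ℝ) ≤ 1536 * logTerm Pi κ (P.index + 1) * B
      + (64 * Fintype.card A + 192 * Fintype.card C) * logTerm Pi κ (P.index + 1)
        / accuracy P.index + 1 := by
  have he := accuracy_pos P.index
  have hL := one_le_logTerm hPi hκ hκ1 (P.index + 1)
  set x : ℝ := 1536 * logTerm Pi κ (P.index + 1) * B
      + (64 * Fintype.card A + 192 * Fintype.card C) * logTerm Pi κ (P.index + 1)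
        / accuracy P.index
  have hx : 0 ≤ x := by positivity
  have hlen : len Pi κ P ≤ ⌈x⌉₊ := by
    refine Nat.sInf_le ⟨p, hp, fun π hπ π' hπ' => ?_⟩
    calc _ ≤ 1536 * logTerm Pi κ (P.index + 1) * (accuracy P.index ^ 2 * B)
          + (64 * Fintype.card A + 192 * Fintype.card C) * logTerm Pi κ (P.index + 1)
            * accuracy P.index := by
          gcongr
          exact hB π hπ π' hπ'
      _ = x * accuracy P.index ^ 2 := by simp only [x]; field_simp
      _ ≤ _ := by gcongr; exact Nat.le_ceil x
  exact (Nat.cast_le.2 hlen).trans (Nat.ceil_lt_add_one hx).le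

lemma Calibrated.freq_le_ctx {P : Phase C A} (h : Calibrated Pi κ M P) (c : C) :
    freq Pi κ P c ≤ 3 * M.ctx.real {c} := by
  have h1 := h.freq_le M hPi hκ hκ1 c
  have h2 : trueFreq Pi κ M P c ≤ M.ctx.real {c} := by
    unfold trueFreq; split_ifs <;> simp
  linarith

/-- The length of the phases `0` and `1` does not depend on the gaps. -/
lemma len_le_of_accuracy_eq_one {P : Phase C A} (h : Calibrated Pi κ M P)
    (he : accuracy P.index = 1) :
    (len Pi κ P : ℝ) ≤
      9300 * (Fintype.card A + Fintype.card C) * logTerm Pi κ (P.index + 1) := by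
  have hL := one_le_logTerm hPi hκ hκ1 (P.index + 1)
  have hA : (1 : ℝ) ≤ Fintype.card A := by exact_mod_cast Fintype.card_pos
  have h1 : (len Pi κ P : ℝ) ≤ _ := len_le_of_weightedSq_le hPi hκ hκ1
    (P := P) (p := fun _ => stdSimplex.barycenter) (fun c a => half_inv_card_le)
    (B := 6 * Fintype.card A) (by positivity) fun π _ π' _ => by
      refine (weightedSq_barycenter_le (freq_nonneg Pi κ P) π π').trans ?_
      have h2 : ∑ c, freq Pi κ P c ≤ 3 := by
        calc _ ≤ ∑ c, 3 * M.ctx.real {c} :=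
              Finset.sum_le_sum fun c _ => h.freq_le_ctx M hPi hκ hκ1 c
          _ = 3 := by rw [← Finset.mul_sum, sum_ctx_real, mul_one]
      rw [he]
      nlinarith
  rw [he, div_one] at h1
  have h2 : 1 ≤ (Fintype.card A : ℝ) * logTerm Pi κ (P.index + 1) :=
    one_le_mul_of_one_le_of_one_le hA hL
  have h3 : 0 ≤ (Fintype.card C : ℝ) * logTerm Pi κ (P.index + 1) := by positivity
  nlinarith

lemma Sound.gapMin_le_accuracy {P : Phase C A} (h : Sound Pi κ M πs P)
    (hcard : ¬ P.active.card ≤ 1) : M.gapMin Pi πs ≤ accuracy P.index := by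
  obtain ⟨π, hπ, hne⟩ := (Finset.one_lt_card_iff_nontrivial.1 (not_le.1 hcard)).exists_ne πs
  exact (gapMin_le M (h.subset hπ) hne).trans (h.gap_le π hπ)

/-- The main estimate: in a phase which is not the last one, the gaps of all active policies are
within the accuracy, so that the length of the phase is governed by the complexity. -/
lemma Sound.len_le_rho {ε : ℝ} (hε : 0 ≤ ε) (hopt : M.IsOptimal Pi πs)
    (hD : 0 < max (M.gapMin Pi πs) ε) {P : Phase C A} (h : Sound Pi κ M πs P)
    (hcard : ¬ P.active.card ≤ 1) (hacc : ¬ accuracy P.index ≤ ε) :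
    (len Pi κ P : ℝ) ≤ 36864 * logTerm Pi κ (P.index + 1) * (M.rho Pi πs ε).toReal
      + (64 * Fintype.card A + 192 * Fintype.card C) * logTerm Pi κ (P.index + 1)
        / accuracy P.index + 1 := by
  have he := accuracy_pos P.index
  have hL := one_le_logTerm hPi hκ hκ1 (P.index + 1)
  have hgm := gapMin_nonneg M hopt
  have hrho : M.rho Pi πs ε ≠ ⊤ :=
    ne_top_of_le_ne_top ENNReal.ofReal_ne_top (rho_le M hD hgm)
  have hden : ∀ π ∈ P.active, max (ε ^ 2) (M.gap Pi πs π ^ 2) ≤ accuracy P.index ^ 2 := by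
    intro π hπ
    refine max_le (pow_le_pow_left₀ hε (not_le.1 hacc).le 2) (pow_le_pow_left₀ ?_ ?_ 2)
    · exact hgm.trans (le_max_right _ _)
    · exact max_le (h.gap_le π hπ) (h.gapMin_le_accuracy M hPi hκ hκ1 hcard)
  set y : ℝ := (64 * Fintype.card A + 192 * Fintype.card C) * logTerm Pi κ (P.index + 1)
        / accuracy P.index + 1 with hy
  have key : ENNReal.ofReal ((len Pi κ P - y) / (36864 * logTerm Pi κ (P.index + 1)))
      ≤ M.rho Pi πs ε := by
    refine le_iInf fun p => ?_
    set obj : ENNReal := ⨆ π ∈ Pi, M.sqNorm (fun c a => (p c : A → ℝ) a)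
        (fun c a => M.phi (ofDet πs) c a - M.phi (ofDet π) c a)
      / ENNReal.ofReal (max (ε ^ 2) (M.gap Pi πs π ^ 2)) with hobj
    rcases eq_or_ne obj ⊤ with htop | htop
    · rw [htop]; exact le_top
    refine ENNReal.ofReal_le_of_le_toReal ?_
    -- the norms of the differences from the optimal policy
    have hW : ∀ π ∈ P.active, weightedSq (fun c => M.ctx.real {c}) (fun c => mixUniform p c)
        (diff πs π) ≤ 2 * (accuracy P.index ^ 2 * obj.toReal) := by
      intro π hπ
      have h1 := ofReal_weightedSq_le_sqNorm M (p := fun c => p c) (q := fun c => mixUniform p c)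
        (fun c a => stdSimplex.zero_le _ a) (mixUniform_pos p) (le_two_mul_mixUniform p) πs π
      have h2 : M.sqNorm (fun c a => (p c : A → ℝ) a)
          (fun c a => M.phi (ofDet πs) c a - M.phi (ofDet π) c a)
          ≤ ENNReal.ofReal (accuracy P.index ^ 2) * obj := by
        have h3 : M.sqNorm (fun c a => (p c : A → ℝ) a)
            (fun c a => M.phi (ofDet πs) c a - M.phi (ofDet π) c a)
            / ENNReal.ofReal (accuracy P.index ^ 2) ≤ obj :=
          (ENNReal.div_le_div le_rfl (ENNReal.ofReal_le_ofReal (hden π hπ))).trans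
            (le_iSup₂ (f := fun π (_ : π ∈ Pi) => M.sqNorm (fun c a => (p c : A → ℝ) a)
              (fun c a => M.phi (ofDet πs) c a - M.phi (ofDet π) c a)
                / ENNReal.ofReal (max (ε ^ 2) (M.gap Pi πs π ^ 2))) π (h.subset hπ))
        rw [ENNReal.div_le_iff (by simpa using by positivity) ENNReal.ofReal_ne_top] at h3
        rwa [mul_comm]
      have h4 : ENNReal.ofReal (weightedSq (fun c => M.ctx.real {c}) (fun c => mixUniform p c)
          (diff πs π)) ≤ ENNReal.ofReal (2 * (accuracy P.index ^ 2 * obj.toReal)) := by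
        refine h1.trans ?_
        rw [ENNReal.ofReal_mul (by norm_num), ENNReal.ofReal_mul (by positivity),
          ENNReal.ofReal_toReal htop, ENNReal.ofReal_ofNat]
        gcongr
      exact (ENNReal.ofReal_le_ofReal_iff (by positivity)).1 h4
    have hlen := len_le_of_weightedSq_le hPi hκ hκ1 (P := P) (le_mixUniform p)
      (B := 24 * obj.toReal) (by positivity) fun π hπ π' hπ' => by
        have hq : ∀ c a, 0 ≤ mixUniform p c a := fun c a => (mixUniform_pos p c a).le
        have h1 : weightedSq (freq Pi κ P) (fun c => mixUniform p c) (diff π π')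
            ≤ 3 * weightedSq (fun c => M.ctx.real {c}) (fun c => mixUniform p c) (diff π π') := by
          unfold weightedSq
          rw [Finset.mul_sum]
          refine Finset.sum_le_sum fun c _ => ?_
          rw [Finset.mul_sum]
          refine Finset.sum_le_sum fun a _ => ?_
          rw [← mul_div_assoc, ← mul_assoc]
          have h2 := hq c a
          have h3 := h.calibrated.freq_le_ctx M hPi hκ hκ1 c
          gcongr
        have h2 := weightedSq_triangle (w := fun c => M.ctx.real {c})
          (fun c => measureReal_nonneg) hq πs π π'
        have h3 := hW π hπ
        have h4 := hW π' hπ'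
        linarith
    rw [div_le_iff₀ (by positivity)]
    linarith
  rw [ENNReal.ofReal_le_iff_le_toReal hrho, div_le_iff₀ (by positivity)] at key
  linarith

end Length

/-! ### The number of samples -/

section Samples

variable [Nonempty A] (M : Instance C A) (Pi : Finset (C → A)) (κ : ℝ) (πs : C → A) (ε : ℝ)

/-- A bound on the number of samples collected before phase `l`. The phases `0` and `1`, whose
length does not depend on the gaps, are covered by the second term. -/
def budget (l : ℕ) : ℝ :=
  36864 * ((l - 2 : ℕ) : ℝ) * logTerm Pi κ l * (M.rho Pi πs ε).toReal
    + 9300 * (Fintype.card A + Fintype.card C) * logTerm Pi κ l * 2 ^ l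

variable {Pi κ πs ε} (hPi : Pi.Nontrivial) (hκ : 0 < κ) (hκ1 : κ < 1) (hε : 0 ≤ ε)
  (hopt : M.IsOptimal Pi πs) (hD : 0 < max (M.gapMin Pi πs) ε)

include hPi hκ hκ1

include hε hopt hD in
lemma Sound.budget_add_len_le {P : Phase C A} (h : Sound Pi κ M πs P)
    (hcard : ¬ P.active.card ≤ 1) (hacc : ¬ accuracy P.index ≤ ε) :
    budget M Pi κ πs ε P.index + len Pi κ P ≤ budget M Pi κ πs ε (P.index + 1) := by
  have hL := one_le_logTerm hPi hκ hκ1 P.index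
  have hLL := logTerm_le_succ hPi hκ P.index
  have hA : (1 : ℝ) ≤ Fintype.card A := by exact_mod_cast Fintype.card_pos
  have hS := card_ctx_pos hPi
  have hrho : 0 ≤ (M.rho Pi πs ε).toReal := ENNReal.toReal_nonneg
  have hlen := h.len_le_rho M hPi hκ hκ1 hε hopt hD hcard hacc
  have hlen1 := len_le_of_accuracy_eq_one M hPi hκ hκ1 h.calibrated
  generalize P.index = l at *
  set L := logTerm Pi κ l
  set Λ := logTerm Pi κ (l + 1)
  set ρ := (M.rho Pi πs ε).toReal
  set a : ℝ := (Fintype.card A : ℝ)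
  set s : ℝ := (Fintype.card C : ℝ)
  have hpow : (1 : ℝ) ≤ 2 ^ l := one_le_pow₀ (by norm_num)
  -- the second term of the budget doubles
  have hsecond : 9300 * (a + s) * L * 2 ^ l + 9300 * (a + s) * Λ * 2 ^ l
      ≤ 9300 * (a + s) * Λ * 2 ^ (l + 1) := by
    have : 9300 * (a + s) * L * 2 ^ l ≤ 9300 * (a + s) * Λ * 2 ^ l := by gcongr
    rw [pow_succ]
    linarith
  have hΛ : 0 ≤ Λ := by linarith
  have hone : 9300 * (a + s) * Λ ≤ 9300 * (a + s) * Λ * 2 ^ l :=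
    le_mul_of_one_le_right (by positivity) hpow
  rcases Nat.lt_or_ge l 2 with hl | hl
  · have he : accuracy l = 1 := by interval_cases l <;> simp
    have h2 : (l - 2 : ℕ) = 0 := by omega
    have h3 : (l + 1 - 2 : ℕ) = 0 := by omega
    have h4 := hlen1 he
    simp only [budget, h2, h3, Nat.cast_zero, mul_zero, zero_mul, zero_add]
    linarith
  · have h3 : ((l + 1 - 2 : ℕ) : ℝ) = ((l - 2 : ℕ) : ℝ) + 1 := by
      rw [show l + 1 - 2 = l - 2 + 1 by omega]; push_cast; ring
    have hinv : 1 / accuracy l ≤ 2 ^ l := by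
      rw [accuracy, one_div_pow, one_div_one_div]
      exact pow_le_pow_right₀ (by norm_num) (by omega)
    have h4 : (64 * a + 192 * s) * Λ / accuracy l ≤ (64 * a + 192 * s) * Λ * 2 ^ l := by
      rw [div_eq_mul_one_div]
      gcongr
    have h5 : 1 ≤ a * Λ * 2 ^ l :=
      one_le_mul_of_one_le_of_one_le (one_le_mul_of_one_le_of_one_le hA (hL.trans hLL)) hpow
    have h6 : 0 ≤ s * Λ * 2 ^ l := by positivity
    have h7 : 36864 * ((l - 2 : ℕ) : ℝ) * L * ρ ≤ 36864 * ((l - 2 : ℕ) : ℝ) * Λ * ρ := by gcongr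
    simp only [budget, h3]
    linarith

section GoodPath

variable {ω : ℕ → Noise C A}
  (hgood : ∀ t, noisyUpdate Pi κ (path Pi κ ω t) (ω t) ∉ badStates Pi κ M)

lemma len_pos {P : Phase C A} {π : C → A} (hπ : π ∈ P.active) : 0 < len Pi κ P := by
  have h1 := len_mul_accuracy_ge (Pi := Pi) (κ := κ) hπ
  have h2 := one_le_logTerm hPi hκ hκ1 (P.index + 1)
  have h3 := card_pos_real (A := A)
  have h4 : (0 : ℝ) < len Pi κ P :=
    pos_of_mul_pos_left ((by positivity : (0 : ℝ) < _).trans_le h1) (accuracy_pos P.index).le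
  exact_mod_cast h4

include hopt hgood in
lemma sound_path (t : ℕ) : Sound Pi κ M πs (path Pi κ ω t).1.phase ∧
    (path Pi κ ω t).1.elapsed < len Pi κ (path Pi κ ω t).1.phase := by
  induction t with
  | zero =>
    have hs : Sound Pi κ M πs (path Pi κ ω 0).1.phase :=
      ⟨Finset.Subset.refl Pi, hopt.1, fun π _ => by
        change _ ≤ accuracy 0
        rw [accuracy_zero]
        exact value_sub_le_one M πs π, Or.inl ⟨rfl, fun c => rfl⟩⟩
    exact ⟨hs, len_pos hPi hκ hκ1 hs.mem⟩
  | succ t ih =>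
    have hg := hgood t
    rw [path, chain, ← path]
    set z := noisyUpdate Pi κ (path Pi κ ω t) (ω t) with hz
    have hphase : z.1.phase = (path Pi κ ω t).1.phase := rfl
    have helapsed : z.1.elapsed = (path Pi κ ω t).1.elapsed + 1 := rfl
    rw [settle]
    split_ifs with hlt
    · exact ⟨hphase ▸ ih.1, hlt⟩
    · have h1 : z.1.elapsed = len Pi κ z.1.phase := by
        have := ih.2
        rw [← hphase] at this
        omega
      have h2 := Sound.next M hPi hκ hκ1 hopt (hphase ▸ ih.1) h1 hg
      exact ⟨h2, len_pos hPi hκ hκ1 h2.mem⟩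

include hε hopt hD hgood in
/-- As long as the algorithm has not stopped, the number of samples is within the budget. -/
lemma time_le_budget {t : ℕ} (ht : ∀ s < t, ¬ Halted ε (path Pi κ ω s).1) :
    (t : ℝ) ≤ (path Pi κ ω t).1.elapsed + budget M Pi κ πs ε (path Pi κ ω t).1.phase.index := by
  induction t with
  | zero =>
    have h : 0 ≤ budget M Pi κ πs ε 0 := by
      have := one_le_logTerm hPi hκ hκ1 0
      simp only [budget, zero_tsub, Nat.cast_zero, mul_zero, zero_mul, zero_add]
      positivity
    simpa [path, chain, initState] using h
  | succ t ih =>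
    have ih := ih fun s hs => ht s (hs.trans (Nat.lt_succ_self t))
    have hsound := sound_path M hPi hκ hκ1 hopt hgood t
    have hnot := ht t (Nat.lt_succ_self t)
    rw [path, chain, ← path]
    set z := noisyUpdate Pi κ (path Pi κ ω t) (ω t) with hz
    have hphase : z.1.phase = (path Pi κ ω t).1.phase := rfl
    have helapsed : z.1.elapsed = (path Pi κ ω t).1.elapsed + 1 := rfl
    rw [settle]
    split_ifs with hlt
    · rw [hphase, helapsed]
      push_cast
      linarith
    · have h1 : ((path Pi κ ω t).1.elapsed : ℝ) + 1 = len Pi κ (path Pi κ ω t).1.phase := by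
        have h2 : (path Pi κ ω t).1.elapsed + 1 = len Pi κ (path Pi κ ω t).1.phase := by
          have := hsound.2
          rw [hphase] at hlt
          omega
        exact_mod_cast h2
      have h3 := hsound.1.budget_add_len_le M hPi hκ hκ1 hε hopt hD
        (fun h => hnot (Or.inl h)) (fun h => hnot (Or.inr h))
      change _ ≤ ((0 : ℕ) : ℝ) + budget M Pi κ πs ε ((path Pi κ ω t).1.phase.index + 1)
      push_cast
      linarith

include hε hopt hD hgood in
/-- If the algorithm does not stop at time `t` or before, then `t + 1` is within the budget of a phase
whose accuracy is at least `Δ_min ∨ ε`. -/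
lemma succ_time_le_budget {t : ℕ} (ht : ∀ s ≤ t, ¬ Halted ε (path Pi κ ω s).1) :
    ∃ l, max (M.gapMin Pi πs) ε ≤ accuracy l ∧
      (t : ℝ) + 1 ≤ budget M Pi κ πs ε (l + 1) := by
  have hsound := sound_path M hPi hκ hκ1 hopt hgood t
  have hnot := ht t le_rfl
  have hcard : ¬ (path Pi κ ω t).1.phase.active.card ≤ 1 := fun h => hnot (Or.inl h)
  have hacc : ¬ accuracy (path Pi κ ω t).1.phase.index ≤ ε := fun h => hnot (Or.inr h)
  have h1 := time_le_budget M hPi hκ hκ1 hε hopt hD hgood fun s hs => ht s (le_of_lt hs)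
  have h2 := hsound.1.budget_add_len_le M hPi hκ hκ1 hε hopt hD hcard hacc
  have h3 : ((path Pi κ ω t).1.elapsed : ℝ) + 1 ≤ len Pi κ (path Pi κ ω t).1.phase := by
    exact_mod_cast hsound.2
  exact ⟨_, max_le (hsound.1.gapMin_le_accuracy M hPi hκ hκ1 hcard) (not_le.1 hacc).le,
    by linarith⟩

end GoodPath

end Samples

/-! ### Comparison with the sample bound -/

/-- The polynomial in the lower order term of the sample bound. The variables are `|C|`, `|A|`,
`log (1/κ)`, `log (1 / (Δ_min ∨ ε))` and `log |Pi|`. -/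
def lowerOrderPoly : MvPolynomial (Fin 5) ℝ :=
  MvPolynomial.C 4000000 * (MvPolynomial.X 0 + MvPolynomial.X 1)
    * (1 + MvPolynomial.X 0 + MvPolynomial.X 2 + MvPolynomial.X 4) * (1 + MvPolynomial.X 3 ^ 2)

lemma eval_lowerOrderPoly (s a k i n : ℝ) :
    MvPolynomial.eval ![s, a, k, i, n] lowerOrderPoly
      = 4000000 * (s + a) * (1 + s + k + n) * (1 + i ^ 2) := by
  simp [lowerOrderPoly]

section Numerics

variable [Nonempty A] (M : Instance C A) {Pi : Finset (C → A)} {κ : ℝ} {πs : C → A} {ε : ℝ}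
  (hPi : Pi.Nontrivial) (hκ : 0 < κ) (hκ1 : κ < 1) (hε : 0 ≤ ε)
  (hopt : M.IsOptimal Pi πs) (hD : 0 < max (M.gapMin Pi πs) ε)

include hPi in
lemma one_le_card_ctx : (1 : ℝ) ≤ Fintype.card C := by
  have h : 0 < Fintype.card C := by exact_mod_cast card_ctx_pos hPi
  exact_mod_cast h

include hPi in
lemma log_two_le_log_card : Real.log 2 ≤ Real.log Pi.card :=
  Real.log_le_log (by norm_num) (by exact_mod_cast Finset.one_lt_card_iff_nontrivial.2 hPi)

include hPi hκ in
lemma log_decomp {D : ℝ} (hD : 0 < D) :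
    Real.log (Fintype.card C * (Pi.card : ℝ) / κ * (1 / D))
      = Real.log (Fintype.card C) + Real.log Pi.card + Real.log (1 / κ) + Real.log (1 / D) := by
  have h1 := card_ctx_pos hPi
  have h2 : (0 : ℝ) < Pi.card := by exact_mod_cast hPi.nonempty.card_pos
  rw [div_eq_mul_one_div, Real.log_mul (by positivity) (by positivity),
    Real.log_mul (by positivity) (by positivity), Real.log_mul (by positivity) (by positivity)]

include hPi hκ in
lemma logTerm_succ_le {l : ℕ} {D : ℝ} (hD : 0 < D) (hl : D ≤ accuracy l) (hκ1 : κ < 1) :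
    logTerm Pi κ (l + 1)
      ≤ 7 * Real.log (Fintype.card C * (Pi.card : ℝ) / κ * (1 / D)) := by
  have hS := one_le_card_ctx hPi
  have hn : (2 : ℝ) ≤ Pi.card := by exact_mod_cast Finset.one_lt_card_iff_nontrivial.2 hPi
  have h4 := four_le_numTests hPi
  have hD1 : D ≤ 1 := hl.trans (accuracy_le_one l)
  have hpow : (2 : ℝ) ^ (l + 1 + 1) ≤ 8 * (1 / D) := by
    have h1 : (2 : ℝ) ^ (l - 1) ≤ 1 / D := by
      rw [le_div_iff₀ hD]
      calc _ ≤ (2 : ℝ) ^ (l - 1) * accuracy l := by gcongr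
        _ = 1 := by rw [accuracy, ← mul_pow]; norm_num
    calc (2 : ℝ) ^ (l + 1 + 1) ≤ 2 ^ (l - 1 + 3) := pow_le_pow_right₀ (by norm_num) (by omega)
      _ = 8 * 2 ^ (l - 1) := by rw [pow_add]; ring
      _ ≤ _ := by gcongr
  have htests : numTests Pi ≤ 3 * (Fintype.card C * (Pi.card : ℝ) ^ 2) := by
    have h1 : (1 : ℝ) ≤ (Pi.card : ℝ) ^ 2 := by nlinarith
    unfold numTests
    nlinarith
  have h1 : logTerm Pi κ (l + 1)
      ≤ Real.log (2 ^ 5 * (Fintype.card C * (Pi.card : ℝ) ^ 2) * (1 / κ) * (1 / D)) := by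
    refine Real.log_le_log (by positivity) ?_
    rw [div_eq_mul_one_div]
    calc (2 : ℝ) ^ (l + 1 + 1) * numTests Pi * (1 / κ)
        ≤ 8 * (1 / D) * (3 * (Fintype.card C * (Pi.card : ℝ) ^ 2)) * (1 / κ) := by gcongr
      _ = 24 * (Fintype.card C * (Pi.card : ℝ) ^ 2 * (1 / κ) * (1 / D)) := by ring
      _ ≤ 32 * (Fintype.card C * (Pi.card : ℝ) ^ 2 * (1 / κ) * (1 / D)) := by
          gcongr
          norm_num
      _ = _ := by ring
  rw [Real.log_mul (by positivity) (by positivity), Real.log_mul (by positivity) (by positivity),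
    Real.log_mul (by positivity) (by positivity), Real.log_mul (by positivity) (by positivity),
    Real.log_pow, Real.log_pow] at h1
  rw [log_decomp hPi hκ hD]
  have h2 := log_two_le_log_card hPi
  have h3 : 0 ≤ Real.log (Fintype.card C) := Real.log_nonneg hS
  have h5 : 0 ≤ Real.log (1 / κ) := Real.log_nonneg (by rw [le_div_iff₀ hκ]; linarith)
  have h6 : 0 ≤ Real.log (1 / D) := Real.log_nonneg (by rw [le_div_iff₀ hD]; linarith)
  push_cast at h1
  linarith

lemma max_rpow_le {x y : ℝ} (hx : 0 ≤ x) (hy : 0 ≤ y) :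
    max (y ^ (5 / 3 : ℝ)) (x ^ (5 / 3 : ℝ)) ≤ max x y ^ (5 / 3 : ℝ) :=
  max_le (Real.rpow_le_rpow hy (le_max_right _ _) (by norm_num))
    (Real.rpow_le_rpow hx (le_max_left _ _) (by norm_num))

lemma max_rpow_pos {x y : ℝ} (h : 0 < max x y) :
    0 < max (y ^ (5 / 3 : ℝ)) (x ^ (5 / 3 : ℝ)) := by
  rcases lt_max_iff.1 h with h | h
  · exact lt_max_of_lt_right (Real.rpow_pos_of_pos h _)
  · exact lt_max_of_lt_left (Real.rpow_pos_of_pos h _)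

include hPi hκ hκ1 hopt hD in
lemma budget_le_sampleBound {l : ℕ} (hl : max (M.gapMin Pi πs) ε ≤ accuracy l) (hε : 0 ≤ ε) :
    budget M Pi κ πs ε (l + 1) ≤ sampleBound 1000 lowerOrderPoly M Pi πs ε κ := by
  have hgm := gapMin_nonneg M hopt
  have hLg := logTerm_succ_le hPi hκ hD hl hκ1
  have hL := one_le_logTerm hPi hκ hκ1 (l + 1)
  simp only [sampleBound, eval_lowerOrderPoly, budget]
  set D := max (M.gapMin Pi πs) ε with hDdef
  set ρ := (M.rho Pi πs ε).toReal
  have hρ : 0 ≤ ρ := ENNReal.toReal_nonneg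
  set Lg := Real.log (Fintype.card C * (Pi.card : ℝ) / κ * (1 / D)) with hLgdef
  set L := logTerm Pi κ (l + 1)
  have hdec := log_decomp hPi hκ hD
  rw [← hLgdef] at hdec
  have hS := one_le_card_ctx hPi
  have hA : (1 : ℝ) ≤ Fintype.card A := by exact_mod_cast Fintype.card_pos
  have hD1 : D ≤ 1 := hl.trans (accuracy_le_one l)
  have hk : 0 ≤ Real.log (1 / κ) := Real.log_nonneg (by rw [le_div_iff₀ hκ]; linarith)
  have hi : 0 ≤ Real.log (1 / D) := Real.log_nonneg (by rw [le_div_iff₀ hD]; linarith)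
  have hn : 0 ≤ Real.log Pi.card := (Real.log_nonneg (by norm_num)).trans (log_two_le_log_card hPi)
  have hlogS := Real.log_le_self (show (0 : ℝ) ≤ Fintype.card C by positivity)
  set s : ℝ := (Fintype.card C : ℝ)
  set a : ℝ := (Fintype.card A : ℝ)
  set k := Real.log (1 / κ)
  set i := Real.log (1 / D) with hidef
  set n := Real.log (Pi.card : ℝ)
  have hLg0 : 0 ≤ Lg := by linarith
  have hpow : (2 : ℝ) ^ (l - 1) ≤ 1 / D := by
    rw [le_div_iff₀ hD]
    calc _ ≤ (2 : ℝ) ^ (l - 1) * accuracy l := by gcongr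
      _ = 1 := by rw [accuracy, ← mul_pow]; norm_num
  refine add_le_add ?_ ?_
  · -- the number of phases is logarithmic
    have hphases : ((l + 1 - 2 : ℕ) : ℝ) * Real.log 2 ≤ i := by
      rw [show l + 1 - 2 = l - 1 by omega, ← Real.log_pow]
      exact Real.log_le_log (by positivity) hpow
    have hlog2 := Real.log_two_gt_d9
    set m : ℝ := ((l + 1 - 2 : ℕ) : ℝ)
    have hm : 0 ≤ m := by positivity
    have hm' : 0.6931 * m ≤ i := by nlinarith
    rw [mul_pow, Real.sq_sqrt hLg0]
    calc 36864 * m * L * ρ ≤ 36864 * m * (7 * Lg) * ρ := by gcongr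
      _ = 258048 * m * Lg * ρ := by ring
      _ ≤ 1000 ^ 2 * i * Lg * ρ :=
        mul_le_mul_of_nonneg_right (mul_le_mul_of_nonneg_right (by linarith) hLg0) hρ
      _ = _ := by ring
  · have hM : max (ε ^ (5 / 3 : ℝ)) (M.gapMin Pi πs ^ (5 / 3 : ℝ)) ≤ D := by
      refine (max_rpow_le hgm hε).trans ?_
      calc D ^ (5 / 3 : ℝ) ≤ D ^ (1 : ℝ) :=
            Real.rpow_le_rpow_of_exponent_ge hD hD1 (by norm_num)
        _ = D := Real.rpow_one D
    have hM0 := max_rpow_pos hD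
    have hp : (2 : ℝ) ^ (l + 1) ≤ 4 * (1 / D) := by
      calc (2 : ℝ) ^ (l + 1) ≤ 2 ^ (l - 1 + 2) := pow_le_pow_right₀ (by norm_num) (by omega)
        _ = 4 * 2 ^ (l - 1) := by rw [pow_add]; ring
        _ ≤ _ := by gcongr
    have hLgs : Lg ≤ (1 + s + k + n) * (1 + i ^ 2) := by
      have h1 : i ≤ 1 + i ^ 2 := by nlinarith [sq_nonneg (i - 1)]
      have h2 : 0 ≤ (s + k + n) * i ^ 2 := by positivity
      nlinarith
    calc 9300 * (a + s) * L * 2 ^ (l + 1)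
        ≤ 9300 * (a + s) * (7 * ((1 + s + k + n) * (1 + i ^ 2))) * (4 * (1 / D)) := by
          gcongr
          linarith
      _ = 260400 * (s + a) * (1 + s + k + n) * (1 + i ^ 2) / D := by ring
      _ ≤ _ := by gcongr; norm_num

include hPi hκ hκ1 hopt hD in
/-- If `ε > 1`, then the first term of the sample bound is negative, but it is outweighed by the
second one. -/
lemma sampleBound_nonneg (hε : 0 ≤ ε) :
    0 ≤ sampleBound 1000 lowerOrderPoly M Pi πs ε κ := by
  have hgm := gapMin_nonneg M hopt
  have hrho := rho_le M hD hgm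
  simp only [sampleBound, eval_lowerOrderPoly]
  have hM0 := max_rpow_pos hD
  have hM := max_rpow_le hgm hε
  set D := max (M.gapMin Pi πs) ε with hDdef
  set ρ := (M.rho Pi πs ε).toReal
  have hρ : 0 ≤ ρ := ENNReal.toReal_nonneg
  set Lg := Real.log (Fintype.card C * (Pi.card : ℝ) / κ * (1 / D)) with hLgdef
  have hdec := log_decomp hPi hκ hD
  rw [← hLgdef] at hdec
  have hS := one_le_card_ctx hPi
  have hA : (1 : ℝ) ≤ Fintype.card A := by exact_mod_cast Fintype.card_pos
  have hk : 0 ≤ Real.log (1 / κ) := Real.log_nonneg (by rw [le_div_iff₀ hκ]; linarith)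
  have hn : 0 ≤ Real.log Pi.card := (Real.log_nonneg (by norm_num)).trans (log_two_le_log_card hPi)
  have hlogS := Real.log_le_self (show (0 : ℝ) ≤ Fintype.card C by positivity)
  set s : ℝ := (Fintype.card C : ℝ)
  set a : ℝ := (Fintype.card A : ℝ)
  set k := Real.log (1 / κ)
  set i := Real.log (1 / D) with hidef
  set n := Real.log (Pi.card : ℝ)
  rcases le_total D 1 with hD1 | hD1
  · have hi : 0 ≤ i := Real.log_nonneg (by rw [le_div_iff₀ hD]; linarith)
    positivity
  · have hi : i ≤ 0 := Real.log_nonpos (by positivity) (by rw [div_le_iff₀ hD]; linarith)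
    have hρ' : ρ ≤ 2 * a / D ^ 2 := by
      have := ENNReal.toReal_mono ENNReal.ofReal_ne_top hrho
      rwa [ENNReal.toReal_ofReal (by positivity)] at this
    have hβ : √Lg ^ 2 ≤ s + k + n := by
      rcases le_total 0 Lg with h | h
      · rw [Real.sq_sqrt h]; linarith
      · rw [Real.sqrt_eq_zero'.2 h, zero_pow two_ne_zero]; positivity
    have hM' : max (ε ^ (5 / 3 : ℝ)) (M.gapMin Pi πs ^ (5 / 3 : ℝ)) ≤ D ^ 2 := by
      refine hM.trans ?_
      calc D ^ (5 / 3 : ℝ) ≤ D ^ (2 : ℝ) := Real.rpow_le_rpow_of_exponent_le hD1 (by norm_num)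
        _ = D ^ 2 := Real.rpow_two D
    have h1 : ρ * ((1000 * √Lg) ^ 2 * -i)
        ≤ 2 * a / D ^ 2 * (1000000 * (s + k + n) * (1 + i ^ 2)) := by
      rw [mul_pow]
      have h2 : -i ≤ 1 + i ^ 2 := by nlinarith [sq_nonneg (i + 1)]
      have h3 : 0 ≤ -i := by linarith
      gcongr
      norm_num
    have h4 : 2 * a / D ^ 2 * (1000000 * (s + k + n) * (1 + i ^ 2))
        ≤ 4000000 * (s + a) * (1 + s + k + n) * (1 + i ^ 2) / D ^ 2 := by
      rw [div_mul_eq_mul_div]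
      refine div_le_div_of_nonneg_right ?_ (by positivity)
      have h5 : 2 * a * (1000000 * (s + k + n) * (1 + i ^ 2))
          = 2000000 * a * (s + k + n) * (1 + i ^ 2) := by ring
      rw [h5]
      gcongr
      · norm_num
      · linarith
      · linarith
    have h6 : 4000000 * (s + a) * (1 + s + k + n) * (1 + i ^ 2) / D ^ 2
        ≤ 4000000 * (s + a) * (1 + s + k + n) * (1 + i ^ 2)
          / max (ε ^ (5 / 3 : ℝ)) (M.gapMin Pi πs ^ (5 / 3 : ℝ)) := by gcongr
    linarith

end Numerics

/-- Unless a test fails, phased elimination stops within the sample bound and returns a policy which is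
accurate enough. -/
theorem elimination_spec {Pi : Finset (C → A)} {ε κ : ℝ} [Nonempty A] (hPi : Pi.Nontrivial)
    (hε : 0 ≤ ε) (hκ : 0 < κ) (hκ1 : κ < 1) (M : Instance C A) {πs : C → A}
    (hopt : M.IsOptimal Pi πs) (hD : 0 < max (M.gapMin Pi πs) ε) :
    ENNReal.ofReal (1 - 2 * κ) ≤
      M.law {ω | ∃ t : ℕ, (elimination Pi κ ε).StopsAt ω t ∧
        (t : ℝ) ≤ sampleBound 1000 lowerOrderPoly M Pi πs ε κ ∧
        (elimination Pi κ ε).output t ((elimination Pi κ ε).history ω t) ∈ Pi ∧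
        M.value πs - M.value ((elimination Pi κ ε).output t
          ((elimination Pi κ ε).history ω t)) ≤ ε} := by
  have hprob : IsProbabilityMeasure M.law := by
    have : IsProbabilityMeasure M.roundLaw := by
      unfold Instance.roundLaw; infer_instance
    unfold Instance.law; infer_instance
  set bad := {ω | ∃ t, noisyUpdate Pi κ (path Pi κ ω t) (ω t)
    ∈ badStates Pi κ M} with hbad
  have hbad_le : M.law bad ≤ ENNReal.ofReal κ :=
    measure_exists_badStates_le M hPi.nonempty hκ
  set good := {ω | ∃ t : ℕ, (elimination Pi κ ε).StopsAt ω t ∧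
    (t : ℝ) ≤ sampleBound 1000 lowerOrderPoly M Pi πs ε κ ∧
    (elimination Pi κ ε).output t
      ((elimination Pi κ ε).history ω t) ∈ Pi ∧
    M.value πs - M.value ((elimination Pi κ ε).output t
      ((elimination Pi κ ε).history ω t)) ≤ ε}
  have hcover : Set.univ ⊆ good ∪ bad := by
    intro ω _
    by_cases hω : ω ∈ bad
    · exact Or.inr hω
    left
    have hgood : ∀ t, noisyUpdate Pi κ (path Pi κ ω t) (ω t)
        ∉ badStates Pi κ M := fun t h => hω ⟨t, h⟩
    have hhalt : ∀ t, (elimination Pi κ ε).history ω t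
        ∈ (elimination Pi κ ε).halt t
          ↔ Halted ε (path Pi κ ω t).1 := fun t => by
      rw [← stateOf_history Pi κ ε ω t]
      rfl
    have hbound : ∀ t : ℕ, (∀ s ≤ t, ¬ Halted ε
        (path Pi κ ω s).1) → ((t + 1 : ℕ) : ℝ) ≤
          sampleBound 1000 lowerOrderPoly M Pi πs ε κ := by
      intro t ht
      obtain ⟨l, hl, hle⟩ :=
        succ_time_le_budget M hPi hκ hκ1 hε hopt hD hgood ht
      push_cast
      exact hle.trans (budget_le_sampleBound M hPi hκ hκ1 hopt hD hl hε)
    have hex : ∃ t, Halted ε (path Pi κ ω t).1 := by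
      by_contra! hno
      obtain ⟨t, ht⟩ := exists_nat_gt
        (sampleBound 1000 lowerOrderPoly M Pi πs ε κ)
      have h1 := hbound t fun s _ => hno s
      push_cast at h1
      linarith
    classical
    have hsound := (sound_path M hPi hκ hκ1 hopt hgood (Nat.find hex)).1
    have hmem := pick_mem ⟨πs, hsound.mem⟩
    have hout : (elimination Pi κ ε).output (Nat.find hex)
        ((elimination Pi κ ε).history ω (Nat.find hex))
        = pick (path Pi κ ω (Nat.find hex)).1.phase.active := by
      rw [← stateOf_history Pi κ ε ω (Nat.find hex)]
      rfl
    refine ⟨Nat.find hex, ⟨(hhalt _).2 (Nat.find_spec hex), fun s hs =>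
      fun h => Nat.find_min hex hs ((hhalt s).1 h)⟩, ?_, ?_, ?_⟩
    · rcases hfind : Nat.find hex with _ | t
      · simpa using sampleBound_nonneg M hPi hκ hκ1 hopt hD hε
      · exact hbound t fun s hs => Nat.find_min hex (by omega)
    · rw [hout]
      exact hsound.subset hmem
    · rw [hout]
      rcases Nat.find_spec hex with hcard | hacc
      · rw [Finset.card_le_one.1 hcard _ hmem _ hsound.mem, sub_self]
        exact hε
      · exact (hsound.gap_le _ hmem).trans hacc
  have h1 : 1 ≤ M.law good + ENNReal.ofReal κ := by
    calc (1 : ENNReal) = M.law Set.univ := measure_univ.symm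
      _ ≤ M.law (good ∪ bad) := measure_mono hcover
      _ ≤ M.law good + M.law bad := measure_union_le _ _
      _ ≤ _ := by gcongr
  calc ENNReal.ofReal (1 - 2 * κ) ≤ ENNReal.ofReal (1 - κ) :=
        ENNReal.ofReal_le_ofReal (by linarith)
    _ = 1 - ENNReal.ofReal κ := by rw [ENNReal.ofReal_sub _ hκ.le, ENNReal.ofReal_one]
    _ ≤ M.law good := tsub_le_iff_right.2 h1

end ContextualBandit

end

theorem corollary1 :
    ∃ (K : ℝ) (P : MvPolynomial (Fin 5) ℝ), 0 < K ∧
      ∀ (C A : Type*) [Fintype C] [DecidableEq C] [MeasurableSpace C] [DiscreteMeasurableSpace C]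
        [Fintype A] [DecidableEq A] [MeasurableSpace A] [DiscreteMeasurableSpace A]
        (Pi : Finset (C → A)) (ε κ : ℝ), Pi.Nontrivial → 0 ≤ ε → 0 < κ → κ < 1 →
        ∃ alg : ContextualBandit.Algorithm C A,
          ∀ (M : ContextualBandit.Instance C A) (πs : C → A), M.IsOptimal Pi πs →
            0 < max (M.gapMin Pi πs) ε →
            ENNReal.ofReal (1 - 2 * κ) ≤
              M.law {ω | ∃ t : ℕ, alg.StopsAt ω t ∧
                (t : ℝ) ≤ ContextualBandit.sampleBound K P M Pi πs ε κ ∧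
                alg.output t (alg.history ω t) ∈ Pi ∧
                M.value πs - M.value (alg.output t (alg.history ω t)) ≤ ε} := by
  refine ⟨1000, ContextualBandit.lowerOrderPoly, by norm_num, ?_⟩
  intro C A _ _ _ _ _ _ _ _ Pi ε κ hPi hε hκ hκ1
  have hA : Nonempty A := by
    obtain ⟨π, -, π', -, h⟩ := hPi
    obtain ⟨c, -⟩ := Function.ne_iff.1 h
    exact ⟨π c⟩
  exact ⟨ContextualBandit.elimination Pi κ ε, fun M πs hopt hD =>
    ContextualBandit.elimination_spec hPi hε hκ hκ1 M hopt hD⟩
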